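/- **Conventions.** A $k$-NOBDD over the variables $x_1,\dots,x_n$ is a nondeterministic leveled oblivious branching program with levels $V_0,\dots,V_{kn}$, a source $s\in V_0$ and a sink $t\in V_{kn}$. It consists of $k$ consecutive layers of $n$ steps each. Every layer reads each variable exactly once, and all layers use the same order. Each node may have any number of outgoing edges labelled $0$ and any number labelled $1$, all leading to the next level. The program computes $f:\{0,1\}^n\to\{0,1\}$ if, for every $\sigma$, $f(\sigma)=1$ if and only if there is an $s$–$t$ path all of whose edges are consistent with $\sigma$. Its width is the maximal number of nodes in a level. For a function $k=k(n)$ and a set $C$ of width functions, $k\text{-}\mathbf{NOBDD}_C$ is the set of families $(f_n)_n$ of Boolean functions $f_n:\{0,1\}^n\to\{0,1\}$ for which there is $v\in C$ such that, for every $n$, $f_n$ is computed by a $k(n)$-NOBDD of width at most $v(n)$. Let $C$ be one of the sets - $\mathtt{const}=\{w : w \text{ is constant}, w>20\}$, - $\mathtt{superpolylog}=\{w : w=O(\log^z n)\text{ for some constant } z\}$, - $\mathtt{sublinear}_\alpha=\{w : w=O(n^\alpha)\}$ for some fixed $0<\alpha<0.5$. **Theorem.** Let $k=k(n)$ and $w=w(n)$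 be integer-valued and $r=r(n)$ real-valued, with $w\in C$, $kw^2=o(n)$, and $k(n)>4$, $w(n)>20$ for all $n$. Suppose that for every $v\in C$ the inequality $r>\frac{48v^2}{w\log_2 w}$ holds for all sufficiently large $n$. Then $$\lfloor k/r\rfloor\text{-}\mathbf{NOBDD}_C\subsetneq k\text{-}\mathbf{NOBDD}_C .$$ Moreover, put $K=\lfloor k/2\rfloor$ and $W=\lfloor (w-1)/3\rfloor$. If $2KW(2W+\lceil\log_2 K\rceil+\lceil\log_2 2W\rceil)<n$ for all sufficiently large $n$, then the two classes are separated by the shuffled address function: $$SAF_{K,W}\in k\text{-}\mathbf{NOBDD}_C\setminus\lfloor k/r\rfloor\text{-}\mathbf{NOBDD}_C .$$ **The function $SAF_{K,W}$.** The input is cut into $2KW$ consecutive blocks of $\lfloor n/(2KW)\rfloor$ bits each. The first $\lceil\log_2 K\rceil$ bits of a block, read as a binary number modulo $K$ (least significant bit first), are its step number. The next $\lceil\log_2 2W\rceil$ bits, read in the same way modulo $2W$, are its address. The value of a block is the sum of its remaining bits modulo $W$. Let $\mathrm{Val}(i,t)$ be the value of the first block with step number $t$ and address $i$. Start with $z=0$.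 For $t=0,\dots,K-1$, first put $u=\mathrm{Val}(z,t)+W$ and then replace $z$ by $\mathrm{Val}(u,t)$. Then $SAF_{K,W}=1$ if all the blocks looked up exist and the final $z$ is positive. Otherwise $SAF_{K,W}=0$. -/

import Mathlib

open Filter Asymptotics

/-- A nondeterministic `k`-OBDD over the `n` Boolean variables indexed by `Fin n`:
a leveled oblivious program with levels `0, …, k * n`. The levels form `k` consecutive layers of
`n` steps each, and in every layer the variables are tested once each, in the same order `order`.
The nodes of level `j` are `Fin (size j)`, all of them test the same variable,
and `edge j b u v` says that there is an edge labelled `b` from the node `u` of level `j`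
to the node `v` of level `j + 1`. Any number of edges with a given label may leave a node. -/
structure KNOBDD (k n : ℕ) where
  /-- the common order in which each layer reads the variables -/
  order : Equiv.Perm (Fin n)
  /-- the number of nodes of each level -/
  size : Fin (k * n + 1) → ℕ
  /-- the labelled edges between consecutive levels -/
  edge : (j : Fin (k * n)) → Bool → Fin (size j.castSucc) → Fin (size j.succ) → Prop
  /-- the source node, on the first level -/
  source : Fin (size 0)
  /-- the (accepting) sink node, on the last level -/
  sink : Fin (size (Fin.last (k * n)))

namespace KNOBDD

variable {k n : ℕ}

/-- The variable tested at level `j`; here `j.modNat` is the residue of `j` modulo `n`,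
the position of level `j` within its layer. -/
def var (P : KNOBDD k n) (j : Fin (k * n)) : Fin n := P.order j.modNat

/-- The width: the maximal number of nodes of a level. -/
def width (P : KNOBDD k n) : ℕ := Finset.univ.sup P.size

/-- There is a source-sink path all of whose edges are consistent with the input `σ`. -/
def Accepts (P : KNOBDD k n) (σ : Fin n → Bool) : Prop :=
  ∃ p : (j : Fin (k * n + 1)) → Fin (P.size j),
    p 0 = P.source ∧ p (Fin.last (k * n)) = P.sink ∧
      ∀ j : Fin (k * n), P.edge j (σ (P.var j)) (p j.castSucc) (p j.succ)

/-- The program computes `f`. -/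
def Computes (P : KNOBDD k n) (f : (Fin n → Bool) → Bool) : Prop :=
  ∀ σ, f σ = true ↔ P.Accepts σ

end KNOBDD

/-- A family of Boolean functions, one for each number `n` of variables. -/
abbrev BoolFamily : Type := (n : ℕ) → (Fin n → Bool) → Bool

/-- The Boolean functions of `n` variables computable by `k`-NOBDDs of width (at most) `w`. -/
def kNOBDDWidth (k n w : ℕ) : Set ((Fin n → Bool) → Bool) :=
  {f | ∃ P : KNOBDD k n, P.width ≤ w ∧ P.Computes f}

/-- The class `k`-NOBDD`_C` for `k = k(n)` and a set `C` of width functions. -/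
def kNOBDDClass (k : ℕ → ℕ) (C : Set (ℕ → ℕ)) : Set BoolFamily :=
  {f | ∃ v ∈ C, ∀ n, f n ∈ kNOBDDWidth (k n) n (v n)}

/-- Constant widths greater than `20`. -/
def constWidth : Set (ℕ → ℕ) := {w | ∃ c : ℕ, 20 < c ∧ ∀ n, w n = c}

/-- Widths `O(log ^ z n)` for some constant `z`. -/
def superpolylogWidth : Set (ℕ → ℕ) :=
  {w | ∃ z : ℝ, (fun n => (w n : ℝ)) =O[atTop] fun n : ℕ => Real.logb 2 (n : ℝ) ^ z}

/-- Widths `O(n ^ α)`. -/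
def sublinearWidth (α : ℝ) : Set (ℕ → ℕ) :=
  {w | (fun n => (w n : ℝ)) =O[atTop] fun n : ℕ => (n : ℝ) ^ α}

/-! ### The shuffled address function

The input is cut into `2kw` consecutive blocks of equal length. The first variables of a block are
its address bits, the others its value bits. "Not found" (the value `-1`) is `none`. -/

namespace SAF

/-- The condition on `n`, `k`, `w` under which the function is considered. -/
def Admissible (n k w : ℕ) : Prop :=
  2 * k * w * (2 * w + Nat.clog 2 k + Nat.clog 2 (2 * w)) < n

/-- Number of variables of a block. -/
def blockLen (n k w : ℕ) : ℕ := n / (2 * k * w)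

/-- Number of address variables of a block. -/
def addrLen (k w : ℕ) : ℕ := Nat.clog 2 k + Nat.clog 2 (2 * w)

/-- Number of value variables of a block. -/
def valLen (n k w : ℕ) : ℕ := blockLen n k w - addrLen k w

/-- The `i`-th input bit, as a number. -/
def bit {n : ℕ} (x : Fin n → Bool) (i : ℕ) : ℕ := if h : i < n then (x ⟨i, h⟩).toNat else 0

variable {n : ℕ} (k w : ℕ) (x : Fin n → Bool)

/-- The `j`-th address bit of block `p`. -/
def addrBit (p j : ℕ) : ℕ := bit x (p * blockLen n k w + j)

/-- The `j`-th value bit of block `p`. -/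
def valBit (p j : ℕ) : ℕ := bit x (p * blockLen n k w + addrLen k w + j)

/-- First part of the address of block `p`: the number of the iteration step. -/
def adrK (p : ℕ) : ℕ := (∑ j ∈ Finset.range (Nat.clog 2 k), addrBit k w x p j * 2 ^ j) % k

/-- Second part of the address of block `p`: the address within an iteration step. -/
def adrW (p : ℕ) : ℕ :=
  (∑ j ∈ Finset.range (Nat.clog 2 (2 * w)), addrBit k w x p (j + Nat.clog 2 k) * 2 ^ j) % (2 * w)

/-- The least block with address `i` within step `t`. -/
def ind (i t : ℕ) : Option ℕ :=
  (List.range (2 * k * w)).find? fun p => adrK k w x p = t ∧ adrW k w x p = i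

/-- The value of the block with address `i` within step `t`. -/
def val (i t : ℕ) : Option ℕ :=
  (ind k w x i t).map fun p => (∑ j ∈ Finset.range (valLen n k w), valBit k w x p j) % w

/-- The first half of step `t`, from the result `prev` of the step before:
the address, in `{w, …, 2w - 1}`, of the next block. -/
def step1 (prev : Option ℕ) (t : ℕ) : Option ℕ :=
  (prev.bind fun i => val k w x i t).map fun v => v + w

/-- The result of the iteration after the steps `0, …, m - 1`; it starts with address `0`. -/
def step2 : ℕ → Option ℕ
  | 0 => some 0
  | t + 1 => (step1 k w x (step2 t) t).bind fun i => val k w x i t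

/-- The shuffled address function `SAF_{k,w}`: the final value exists and is positive. -/
def fn : Bool := (step2 k w x k).any fun v => decide (0 < v)

end SAF

/-- The family `SAF_{k(n),w(n)}`. -/
def SAFFamily (k w : ℕ → ℕ) : BoolFamily := fun n x => SAF.fn (k n) (w n) x

/-!
The classes increase with the number of layers, because a program can wait in its sink
(`kNOBDDWidth_mono_layers`), and the inequality for `r` with `v = w` gives `r ≥ 1` for large `n`.
Finitely many `n` never matter: every function has a one-layer program of width `2 ^ n + 1`
(`mem_kNOBDDWidth_two_pow`), and each of the classes `C` allows finitely many exceptional widths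
(`IsWidthClass.mem_kNOBDDClass`).

*Few layers do not suffice for the shuffled address function.* Cut the variable order of a program
with `k'` layers and width `v` into two parts. The behaviour of the program on the first part is
described by `k'` relations on `v` nodes, so the assignments of the first part induce at most
`2 ^ (v ^ 2 * k')` functions of the second (`exists_order_forall_card_le`). For every order there is
a moment when exactly half of the blocks have `W` value bits that are already read (`exists_cut`),
and the other half then have `W` unread ones. Give to the first half the addresses below `W` and to
the second half those from `W` on. Then the function computes the composition of `2K` maps on
`{0, …, W - 1}`, of which every second one is given in the first part. Fixing these maps at `0` and
`1`, the others can route the iteration to any point of a map and carry the answer to the end. So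
there are at least `W ^ ((K - 1) * (W - 2))` functions of the second part (`pow_le_of_fn_mem`).

*Two layers for each step suffice.* One layer performs one look-up deterministically
(`Lookup.fn_mem_kNOBDDWidth`). The residue of a number of `⌈log₂ M⌉` bits modulo `M` is tested
by comparing its bits with those of two numbers, so besides the address only four flags are
remembered, and the width is `O(W)`.

*When the blocks are too short.* The assumption `k w ^ 2 = o(n)` alone does not make the blocks
long enough for their addresses. If they are too short, then `w` is at most logarithmic and `k`
almost linear in `n`, and counting suffices: with `k` layers and width `w ^ 2 + 3` one can compute
`2 ^ (k * w ^ 2 * (n / 2))` distinct functions, which take the entries of an arbitrary 0-1 matrix as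
values on inputs with two ones (`Pair.pairFn_eq`), but there are fewer programs with `⌊k / r⌋`
layers (`exists_mem_notMem_of_not_admissible`). For the strict inclusion the two functions
are combined into one family, according to which of the cases holds for `n`.
-/

/-! ### Programs as walks on natural numbers -/

/-- The bit of the input `σ` that is read in step `j` of a program with variable order `π`
(the value `false` for `n = 0`, when there are no steps, is never used). -/
def readBit {n : ℕ} (π : Equiv.Perm (Fin n)) (σ : Fin n → Bool) (j : ℕ) : Bool :=
  if h : 0 < n then σ (π ⟨j % n, Nat.mod_lt _ h⟩) else false

/-- Acceptance of `σ` by a program of `m` steps whose nodes are natural numbers below `V`: there is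
a walk `p` from `s` to `t` all of whose edges belong to `E` and are consistent with `σ`. -/
def WalkAccepts {n : ℕ} (m V : ℕ) (π : Equiv.Perm (Fin n)) (E : ℕ → Bool → ℕ → ℕ → Prop)
    (s t : ℕ) (σ : Fin n → Bool) : Prop :=
  ∃ p : ℕ → ℕ, p 0 = s ∧ p m = t ∧ (∀ j ≤ m, p j < V) ∧
    ∀ j < m, E j (readBit π σ j) (p j) (p (j + 1))

theorem readBit_eq {k n : ℕ} (π : Equiv.Perm (Fin n)) (σ : Fin n → Bool) (j : Fin (k * n)) :
    readBit π σ j = σ (π j.modNat) := by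
  have hn : 0 < n := by
    rcases Nat.eq_zero_or_pos n with rfl | h
    · exact absurd j.isLt (by simp)
    · exact h
  simp only [readBit, hn, dif_pos]
  congr 2

/-- Normal form of a program of width at most `V`: the dependent node types `Fin (size j)` are
replaced by natural numbers below `V`. -/
theorem mem_kNOBDDWidth_iff {k n V : ℕ} {f : (Fin n → Bool) → Bool} :
    f ∈ kNOBDDWidth k n V ↔ ∃ (π : Equiv.Perm (Fin n)) (E : ℕ → Bool → ℕ → ℕ → Prop) (s t : ℕ),
      s < V ∧ t < V ∧ ∀ σ, f σ = true ↔ WalkAccepts (k * n) V π E s t σ := by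
  constructor
  · rintro ⟨P, hPw, hP⟩
    have hsize : ∀ j, P.size j ≤ V := fun j => (Finset.le_sup (Finset.mem_univ j)).trans hPw
    refine ⟨P.order, fun j b u v => ∃ (hj : j < k * n) (hu : u < P.size (Fin.castSucc ⟨j, hj⟩))
      (hv : v < P.size (Fin.succ ⟨j, hj⟩)), P.edge ⟨j, hj⟩ b ⟨u, hu⟩ ⟨v, hv⟩, P.source, P.sink,
      P.source.isLt.trans_le (hsize _), P.sink.isLt.trans_le (hsize _), fun σ => ?_⟩
    rw [hP σ]
    constructor
    · rintro ⟨q, h0, h1, he⟩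
      refine ⟨fun j => if h : j < k * n + 1 then q ⟨j, h⟩ else 0, ?_, ?_, ?_, ?_⟩
      · simpa using congrArg Fin.val h0
      · simp only [Nat.lt_succ_self, dif_pos]
        exact congrArg Fin.val h1
      · intro j hj
        simp only [Nat.lt_succ_of_le hj, dif_pos]
        exact (q _).isLt.trans_le (hsize _)
      · intro j hj
        have h1 : j < k * n + 1 := by omega
        have h2 : j + 1 < k * n + 1 := by omega
        simp only [h1, h2, dif_pos]
        refine ⟨hj, (q (Fin.castSucc ⟨j, hj⟩)).isLt, (q (Fin.succ ⟨j, hj⟩)).isLt, ?_⟩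
        rw [readBit_eq P.order σ ⟨j, hj⟩]
        exact he ⟨j, hj⟩
    · rintro ⟨p, h0, h1, -, he⟩
      have hb : ∀ j (hj : j < k * n + 1), p j < P.size ⟨j, hj⟩ := by
        intro j hj
        cases j with
        | zero => rw [h0]; exact P.source.isLt
        | succ i =>
          obtain ⟨_, _, hv, _⟩ := he i (by omega)
          exact hv
      refine ⟨fun j => ⟨p j, hb j j.isLt⟩, Fin.ext h0, Fin.ext h1, fun j => ?_⟩
      obtain ⟨_, _, _, h⟩ := he j j.isLt
      rw [readBit_eq] at h
      exact h
  · rintro ⟨π, E, s, t, hs, ht, h⟩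
    refine ⟨⟨π, fun _ => V, fun j b u v => E j b u v, ⟨s, hs⟩, ⟨t, ht⟩⟩,
      Finset.sup_le fun _ _ => le_rfl, fun σ => ?_⟩
    rw [h σ]
    constructor
    · rintro ⟨p, h0, h1, hV, he⟩
      refine ⟨fun j => ⟨p j, hV j (Nat.lt_succ_iff.1 j.isLt)⟩, Fin.ext h0, Fin.ext h1, fun j => ?_⟩
      have := he j j.isLt
      rw [readBit_eq] at this
      exact this
    · rintro ⟨q, h0, h1, he⟩
      refine ⟨fun j => if h : j < k * n + 1 then q ⟨j, h⟩ else 0, ?_, ?_, ?_, ?_⟩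
      · simpa using congrArg Fin.val h0
      · simp only [Nat.lt_succ_self, dif_pos]
        exact congrArg Fin.val h1
      · intro j hj
        simp only [Nat.lt_succ_of_le hj, dif_pos]
        exact (q _).isLt
      · intro j hj
        have h1 : j < k * n + 1 := by omega
        have h2 : j + 1 < k * n + 1 := by omega
        simp only [h1, h2, dif_pos]
        rw [readBit_eq π σ ⟨j, hj⟩]
        exact he ⟨j, hj⟩

theorem kNOBDDWidth_mono {k n v V : ℕ} (h : v ≤ V) : kNOBDDWidth k n v ⊆ kNOBDDWidth k n V :=
  fun _ ⟨P, hw, hP⟩ => ⟨P, hw.trans h, hP⟩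

/-- Layers may be added: after its last step the shorter program waits in its sink. -/
theorem kNOBDDWidth_mono_layers {k k' n V : ℕ} (h : k' ≤ k) :
    kNOBDDWidth k' n V ⊆ kNOBDDWidth k n V := by
  intro f hf
  rw [mem_kNOBDDWidth_iff] at hf ⊢
  obtain ⟨π, E, s, t, hs, ht, hf⟩ := hf
  have hle : k' * n ≤ k * n := Nat.mul_le_mul_right _ h
  refine ⟨π, fun j b u v => (j < k' * n → E j b u v) ∧ (k' * n ≤ j → u = v), s, t, hs, ht,
    fun σ => ?_⟩
  rw [hf]
  constructor
  · rintro ⟨p, h0, h1, hV, he⟩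
    refine ⟨fun j => p (min j (k' * n)), by simpa using h0, by simpa [hle] using h1,
      fun j _ => hV _ (min_le_right _ _), fun j _ => ⟨fun hj => ?_, fun hj => ?_⟩⟩
    · simp only [min_eq_left hj.le, min_eq_left (Nat.succ_le_of_lt hj)]
      exact he j hj
    · simp only [min_eq_right hj, min_eq_right (hj.trans (Nat.le_succ j))]
  · rintro ⟨p, h0, h1, hV, he⟩
    refine ⟨p, h0, ?_, fun j hj => hV j (hj.trans hle), fun j hj => (he j (by omega)).1 hj⟩
    have key : ∀ d, k' * n + d ≤ k * n → p (k' * n + d) = p (k' * n) := by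
      intro d
      induction d with
      | zero => simp
      | succ d ih =>
        intro hd
        rw [← ih (by omega)]
        exact ((he (k' * n + d) (by omega)).2 (by omega)).symm
    rw [← h1, ← key (k * n - k' * n) (by omega)]
    congr 1
    omega

/-- Deterministic programs: if `g j x` is the state reached by the input `x` after `j` steps,
if the state after the next step depends only on this state and on the bit read, and if the last
state determines the value of `f`, then `f` has a program whose nodes are the states and one
further node (which allows the accepting states to be merged into a single sink). -/
theorem mem_kNOBDDWidth_of_state {k n : ℕ} {f : (Fin n → Bool) → Bool} {T : Type*}
    (S : Finset T) (g : ℕ → (Fin n → Bool) → T) (hS : ∀ j ≤ k * n, ∀ x, g j x ∈ S)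
    (h0 : ∀ x y, g 0 x = g 0 y)
    (hstep : ∀ j < k * n, ∀ x y, g j x = g j y → readBit 1 x j = readBit 1 y j →
      g (j + 1) x = g (j + 1) y)
    (hf : ∀ x y, g (k * n) x = g (k * n) y → f x = f y) :
    f ∈ kNOBDDWidth k n (S.card + 1) := by
  classical
  let enc : T → ℕ := fun a => if h : a ∈ S then S.equivFin ⟨a, h⟩ else 0
  have henc : ∀ a ∈ S, ∀ b ∈ S, enc a = enc b → a = b := by
    intro a ha b hb h
    simp only [enc, ha, hb, dif_pos] at h
    simpa using S.equivFin.injective (Fin.ext h)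
  have hlt : ∀ a ∈ S, enc a < S.card := by
    intro a ha
    simp only [enc, ha, dif_pos]
    exact Fin.is_lt _
  have hpos : 0 < S.card := Finset.card_pos.2 ⟨_, hS 0 (Nat.zero_le _) fun _ => false⟩
  let G : ℕ → (Fin n → Bool) → ℕ := fun j x =>
    if j < k * n then enc (g j x) else if f x then S.card else 0
  have hGlt : ∀ j ≤ k * n, ∀ x, G j x < S.card + 1 := by
    intro j hj x
    simp only [G]
    have := hlt _ (hS j hj x)
    split_ifs <;> omega
  have hG0 : ∀ x y, G 0 x = G 0 y := by
    intro x y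
    simp only [G, h0 x y]
    split_ifs with h h1 h2 h2
    · rfl
    · rfl
    · have := hf x y (by rw [Nat.eq_zero_of_not_pos h]; exact h0 x y)
      simp_all
    · have := hf x y (by rw [Nat.eq_zero_of_not_pos h]; exact h0 x y)
      simp_all
    · rfl
  have hGstep : ∀ j < k * n, ∀ x y, G j x = G j y → readBit 1 x j = readBit 1 y j →
      G (j + 1) x = G (j + 1) y := by
    intro j hj x y hxy hb
    simp only [G, hj, if_true] at hxy
    have hg := hstep j hj x y (henc _ (hS j hj.le x) _ (hS j hj.le y) hxy) hb
    simp only [G, hg]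
    split_ifs with h h1 h2 h2
    · rfl
    · rfl
    · have hj' : j + 1 = k * n := by omega
      have := hf x y (by rw [← hj', hg])
      simp_all
    · have hj' : j + 1 = k * n := by omega
      have := hf x y (by rw [← hj', hg])
      simp_all
    · rfl
  rw [mem_kNOBDDWidth_iff]
  refine ⟨1, fun j b u v => ∃ x, readBit 1 x j = b ∧ u = G j x ∧ v = G (j + 1) x,
    G 0 fun _ => false, S.card, hGlt 0 (Nat.zero_le _) _, Nat.lt_succ_self _, fun σ => ?_⟩
  have hacc : f σ = true ↔ G (k * n) σ = S.card := by
    simp only [G, lt_irrefl, if_false]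
    split_ifs with h <;> simp [h]
    omega
  rw [hacc]
  constructor
  · intro h
    exact ⟨fun j => G j σ, hG0 _ _, h, fun j hj => hGlt j hj σ, fun j _ => ⟨σ, rfl, rfl, rfl⟩⟩
  · rintro ⟨p, hp0, hp1, -, he⟩
    have key : ∀ j ≤ k * n, p j = G j σ := by
      intro j
      induction j with
      | zero => intro _; rw [hp0]; exact hG0 _ _
      | succ j ih =>
        intro hj
        obtain ⟨x, hb, hu, hv⟩ := he j (by omega)
        rw [hv]
        exact hGstep j (by omega) x σ (by rw [← hu, ih (by omega)]) hb
    rw [← key _ le_rfl, hp1]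

/-- Every Boolean function has a program of one layer that remembers the whole input. -/
theorem mem_kNOBDDWidth_two_pow {k n : ℕ} (hk : 0 < k) (f : (Fin n → Bool) → Bool) :
    f ∈ kNOBDDWidth k n (2 ^ n + 1) := by
  have := mem_kNOBDDWidth_of_state (k := k) (f := f) Finset.univ
    (fun j x => (fun i => if (i : ℕ) < j then x i else false : Fin n → Bool))
    (fun _ _ _ => Finset.mem_univ _) (fun x y => by simp) ?_ ?_
  · simpa using this
  · intro j hj x y hxy hb
    have hn : 0 < n := by
      rcases Nat.eq_zero_or_pos n with rfl | h
      · simp at hj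
      · exact h
    funext i
    have hi := congrFun hxy i
    rcases lt_trichotomy (i : ℕ) j with h | h | h
    · simpa [h, h.trans (Nat.lt_succ_self j)] using hi
    · have : (⟨j % n, Nat.mod_lt _ hn⟩ : Fin n) = i :=
        Fin.ext (by simp [← h, Nat.mod_eq_of_lt i.isLt])
      simpa [readBit, hn, this, h] using hb
    · have : ¬ (i : ℕ) < j + 1 := by omega
      simp [this]
  · intro x y hxy
    congr 1
    funext i
    have hi := congrFun hxy i
    have : (i : ℕ) < k * n := i.isLt.trans_le (Nat.le_mul_of_pos_left _ hk)
    simpa [this] using hi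

/-! ### Communication bound for programs with few layers -/

theorem readBit_congr {n : ℕ} {π : Equiv.Perm (Fin n)} {σ τ : Fin n → Bool} {j : ℕ}
    (h : ∀ x, (π.symm x : ℕ) = j % n → σ x = τ x) : readBit π σ j = readBit π τ j := by
  unfold readBit
  split_ifs with hn
  · exact h _ (by simp)
  · rfl

/-- Cut the variable order `π` of a program with `k` layers and width `V` after `u` variables, and
let the inputs `σ a b` depend on `a` on the first `u` variables and on `b` on the others. The
behaviour of the program on the first part is described by one relation on the nodes for each
layer. So the function computed cannot tell apart more than `2 ^ (V ^ 2 * k)` values of `a`. -/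
theorem exists_order_forall_card_le {k n V : ℕ} {f : (Fin n → Bool) → Bool}
    (hf : f ∈ kNOBDDWidth k n V) : ∃ π : Equiv.Perm (Fin n), ∀ u ≤ n,
      ∀ (ι κ : Type) [Fintype ι] (σ : ι → κ → Fin n → Bool),
      (∀ a b b' x, (π.symm x : ℕ) < u → σ a b x = σ a b' x) →
      (∀ a a' b x, u ≤ (π.symm x : ℕ) → σ a b x = σ a' b x) →
      (∀ a a', a ≠ a' → ∃ b, f (σ a b) ≠ f (σ a' b)) →
      Fintype.card ι ≤ 2 ^ (V ^ 2 * k) := by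
  classical
  rw [mem_kNOBDDWidth_iff] at hf
  obtain ⟨π, E, s, t, hs, ht, hf⟩ := hf
  refine ⟨π, fun u hu ι κ _ σ hA hB hsep => ?_⟩
  let R : ι → Fin k → Fin V → Fin V → Prop := fun a l c d => ∃ b, ∃ q : ℕ → ℕ,
    q (l * n) = c ∧ q (l * n + u) = d ∧ (∀ j, l * n ≤ j → j ≤ l * n + u → q j < V) ∧
    ∀ j, l * n ≤ j → j < l * n + u → E j (readBit π (σ a b) j) (q j) (q (j + 1))
  have key : ∀ a a' b, R a = R a' → f (σ a b) = true → f (σ a' b) = true := by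
    intro a a' b hR h
    rw [hf] at h ⊢
    obtain ⟨p, h0, h1, hV, he⟩ := h
    have hlay : ∀ l < k, l * n + n ≤ k * n := fun l hl => by
      rw [← Nat.succ_mul]; exact Nat.mul_le_mul_right _ hl
    have hex : ∀ l : Fin k, ∃ b', ∃ q : ℕ → ℕ, q (l * n) = p (l * n) ∧
        q (l * n + u) = p (l * n + u) ∧ (∀ j, l * n ≤ j → j ≤ l * n + u → q j < V) ∧
        ∀ j, l * n ≤ j → j < l * n + u → E j (readBit π (σ a' b') j) (q j) (q (j + 1)) := by
      intro l
      have hl := hlay l l.isLt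
      have : R a l ⟨p (l * n), hV _ (by omega)⟩ ⟨p (l * n + u), hV _ (by omega)⟩ :=
        ⟨b, p, rfl, rfl, fun j _ _ => hV _ (by omega), fun j _ _ => he j (by omega)⟩
      rw [hR] at this
      exact this
    choose b' q hq0 hq1 hqV hqE using hex
    let p' : ℕ → ℕ := fun j => if h : j / n < k ∧ j % n < u then q ⟨j / n, h.1⟩ j else p j
    have hmul : ∀ l, p' (l * n) = p (l * n) := by
      intro l
      simp only [p']
      split_ifs with h
      · have hn : 0 < n := by omega
        have hl : l * n / n = l := Nat.mul_div_cancel _ hn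
        have := hq0 ⟨l * n / n, h.1⟩
        simp only [hl] at this ⊢
        exact this
      · rfl
    have hend : ∀ l < k, p' (l * n + u) = p (l * n + u) := by
      intro l hl
      rcases hu.eq_or_lt with rfl | hu'
      · rw [← Nat.succ_mul, hmul]
      · simp only [p']
        rw [dif_neg]
        rw [mul_comm, Nat.mul_add_mod, Nat.mod_eq_of_lt hu']
        omega
    have hin : ∀ l (hl : l < k), ∀ m ≤ u, p' (l * n + m) = q ⟨l, hl⟩ (l * n + m) := by
      intro l hl m hm
      rcases hm.eq_or_lt with rfl | hm'
      · rw [hend l hl, ← hq1 ⟨l, hl⟩]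
      · have h1 : (l * n + m) / n = l := by
          rw [mul_comm, Nat.mul_add_div (by omega), Nat.div_eq_of_lt (by omega), add_zero]
        have h2 : (l * n + m) % n = m := by
          rw [mul_comm, Nat.mul_add_mod, Nat.mod_eq_of_lt (by omega)]
        simp only [p']
        rw [dif_pos ⟨by omega, by omega⟩]
        simp only [h1]
    have hout : ∀ l < k, ∀ m, u ≤ m → m ≤ n → p' (l * n + m) = p (l * n + m) := by
      intro l hl m hm hmn
      rcases hmn.eq_or_lt with rfl | hm'
      · rw [← Nat.succ_mul, hmul]
      · simp only [p']
        rw [dif_neg]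
        rw [mul_comm, Nat.mul_add_mod, Nat.mod_eq_of_lt hm']
        omega
    refine ⟨p', ?_, ?_, ?_, ?_⟩
    · have := hmul 0
      rwa [Nat.zero_mul, h0] at this
    · rw [hmul, h1]
    · intro j hj
      simp only [p']
      split_ifs with h
      · have := Nat.div_add_mod j n
        have hc := Nat.mul_comm n (j / n)
        exact hqV _ _ (by simp only; omega) (by simp only; omega)
      · exact hV j hj
    · intro j hj
      have hn : 0 < n := Nat.pos_of_ne_zero fun h => by simp [h] at hj
      have hl : j / n < k := Nat.div_lt_of_lt_mul (by rwa [mul_comm])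
      have hm := Nat.mod_lt j hn
      have hjeq : j = j / n * n + j % n := by
        rw [mul_comm]; exact (Nat.div_add_mod j n).symm
      rcases lt_or_ge (j % n) u with hmu | hmu
      · have e1 := hin _ hl _ hmu.le
        have e2 := hin _ hl _ (Nat.succ_le_of_lt hmu)
        have e3 := hqE ⟨j / n, hl⟩ j (by simp only; omega) (by simp only; omega)
        rw [Nat.succ_eq_add_one, ← add_assoc, ← hjeq] at e2
        rw [← hjeq] at e1
        rw [e1, e2, readBit_congr (τ := σ a' (b' ⟨j / n, hl⟩))]
        · exact e3
        · exact fun x hx => hA _ _ _ _ (by omega)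
      · have e1 := hout _ hl _ hmu hm.le
        have e2 := hout _ hl _ (hmu.trans (Nat.le_succ _)) hm
        rw [Nat.succ_eq_add_one, ← add_assoc, ← hjeq] at e2
        rw [← hjeq] at e1
        rw [e1, e2, readBit_congr (τ := σ a b)]
        · exact he j hj
        · exact fun x hx => hB _ _ _ _ (by omega)
  have hinj : Function.Injective R := by
    intro a a' hR
    by_contra hne
    obtain ⟨b, hb⟩ := hsep a a' hne
    exact hb (Bool.eq_iff_iff.2 ⟨key a a' b hR, key a' a b hR.symm⟩)
  refine (Fintype.card_le_of_injective R hinj).trans (le_of_eq ?_)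
  simp only [Fintype.card_fun, Fintype.card_prop, Fintype.card_fin]
  rw [← pow_mul, ← pow_mul, sq, mul_assoc]

/-! ### The shuffled address function on inputs with distinct block addresses -/

/-- The result of `t` steps of the iteration when the block with address `i` of step `t` has
the value `c t i`. -/
def iterVal (W : ℕ) (c : ℕ → ℕ → ℕ) : ℕ → ℕ
  | 0 => 0
  | t + 1 => c t (c t (iterVal W c t) + W)

theorem iterVal_lt {W : ℕ} (hW : 0 < W) {c : ℕ → ℕ → ℕ} (hc : ∀ t i, c t i < W) (t : ℕ) :
    iterVal W c t < W := by
  cases t with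
  | zero => exact hW
  | succ t => exact hc _ _

/-- If every address occurs in exactly one block, then every look-up succeeds. -/
theorem fn_eq_decide_iterVal {n K W : ℕ} (hW : 0 < W) {x : Fin n → Bool}
    (e : Fin K × Fin (2 * W) ≃ Fin (2 * K * W)) {c : ℕ → ℕ → ℕ} (hc : ∀ t i, c t i < W)
    (hK : ∀ y, SAF.adrK K W x (e y) = y.1) (hA : ∀ y, SAF.adrW K W x (e y) = y.2)
    (hv : ∀ y, (∑ j ∈ Finset.range (SAF.valLen n K W), SAF.valBit K W x (e y) j) % W =
      c y.1 y.2) :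
    SAF.fn K W x = decide (0 < iterVal W c K) := by
  have hind : ∀ t (ht : t < K) i (hi : i < 2 * W),
      SAF.ind K W x i t = some (e (⟨t, ht⟩, ⟨i, hi⟩) : ℕ) := by
    intro t ht i hi
    unfold SAF.ind
    rw [List.find?_range_eq_some]
    refine ⟨by simp [hK, hA], List.mem_range.2 (Fin.is_lt _), fun j hj => ?_⟩
    have hj' : j < 2 * K * W := hj.trans (Fin.is_lt _)
    have h1 := hK (e.symm ⟨j, hj'⟩)
    have h2 := hA (e.symm ⟨j, hj'⟩)
    rw [Equiv.apply_symm_apply] at h1 h2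
    simp only at h1 h2
    simp only [h1, h2, Bool.not_eq_true', decide_eq_false_iff_not]
    rintro ⟨h3, h4⟩
    have : e.symm ⟨j, hj'⟩ = (⟨t, ht⟩, ⟨i, hi⟩) := Prod.ext (Fin.ext h3) (Fin.ext h4)
    rw [← this, Equiv.apply_symm_apply] at hj
    exact lt_irrefl _ hj
  have hval : ∀ t < K, ∀ i < 2 * W, SAF.val K W x i t = some (c t i) := by
    intro t ht i hi
    rw [SAF.val, hind t ht i hi, Option.map_some, hv]
  have hstep : ∀ t ≤ K, SAF.step2 K W x t = some (iterVal W c t) := by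
    intro t
    induction t with
    | zero => intro _; rfl
    | succ t ih =>
      intro ht
      have h1 := iterVal_lt hW hc t
      have h2 := hc t (iterVal W c t)
      rw [SAF.step2, SAF.step1, ih (by omega), Option.bind_some, hval t (by omega) _ (by omega),
        Option.map_some, Option.bind_some, hval t (by omega) _ (by omega)]
      rfl
  rw [SAF.fn, hstep K le_rfl]
  rfl

theorem sum_testBit_mul_two_pow (a m : ℕ) :
    ∑ j ∈ Finset.range m, (a.testBit j).toNat * 2 ^ j = a % 2 ^ m := by
  induction m with
  | zero => simp [Nat.mod_one]
  | succ m ih => rw [Finset.sum_range_succ, ih, Nat.mod_pow_succ, Nat.toNat_testBit, mul_comm]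

/-- The input whose block `e (t, i)` has the step number `t` and the address `i`, and whose value
bits equal to `1` are those of the set `T (t, i) (c t i)`. -/
def blockInput {n K W : ℕ} (e : Fin K × Fin (2 * W) ≃ Fin (2 * K * W))
    (T : Fin K × Fin (2 * W) → ℕ → Finset ℕ) (c : ℕ → ℕ → ℕ) (x : Fin n) : Bool :=
  if h : (x : ℕ) / SAF.blockLen n K W < 2 * K * W then
    let y := e.symm ⟨x / SAF.blockLen n K W, h⟩
    let q := x % SAF.blockLen n K W
    if q < Nat.clog 2 K then (y.1 : ℕ).testBit q
    else if q < SAF.addrLen K W then (y.2 : ℕ).testBit (q - Nat.clog 2 K)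
    else decide (q - SAF.addrLen K W ∈ T y (c y.1 y.2))
  else false

theorem index_lt {n K W p q : ℕ} (hp : p < 2 * K * W) (hq : q < SAF.blockLen n K W) :
    p * SAF.blockLen n K W + q < n := by
  calc p * SAF.blockLen n K W + q < (p + 1) * SAF.blockLen n K W := by rw [Nat.succ_mul]; omega
    _ ≤ 2 * K * W * SAF.blockLen n K W := Nat.mul_le_mul_right _ hp
    _ ≤ n := Nat.mul_div_le _ _

theorem bit_blockInput {n K W : ℕ} (e : Fin K × Fin (2 * W) ≃ Fin (2 * K * W))
    (T : Fin K × Fin (2 * W) → ℕ → Finset ℕ) (c : ℕ → ℕ → ℕ) (y : Fin K × Fin (2 * W)) {q : ℕ}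
    (hq : q < SAF.blockLen n K W) :
    SAF.bit (blockInput (n := n) e T c) (e y * SAF.blockLen n K W + q) =
      (if q < Nat.clog 2 K then (y.1 : ℕ).testBit q
      else if q < SAF.addrLen K W then (y.2 : ℕ).testBit (q - Nat.clog 2 K)
      else decide (q - SAF.addrLen K W ∈ T y (c y.1 y.2))).toNat := by
  have h1 : (e y * SAF.blockLen n K W + q) / SAF.blockLen n K W = e y := by
    rw [mul_comm, Nat.mul_add_div (by omega), Nat.div_eq_of_lt hq, add_zero]
  have h2 : (e y * SAF.blockLen n K W + q) % SAF.blockLen n K W = q := by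
    rw [mul_comm, Nat.mul_add_mod, Nat.mod_eq_of_lt hq]
  rw [SAF.bit, dif_pos (index_lt (e y).isLt hq)]
  simp only [blockInput, h1, h2, Fin.is_lt, dif_pos, Fin.eta, Equiv.symm_apply_apply]

theorem adrK_blockInput {n K W : ℕ} (hL : SAF.addrLen K W ≤ SAF.blockLen n K W)
    (e : Fin K × Fin (2 * W) ≃ Fin (2 * K * W))
    (T : Fin K × Fin (2 * W) → ℕ → Finset ℕ) (c : ℕ → ℕ → ℕ) (y : Fin K × Fin (2 * W)) :
    SAF.adrK K W (blockInput (n := n) e T c) (e y) = y.1 := by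
  have hlt : (y.1 : ℕ) < 2 ^ Nat.clog 2 K :=
    y.1.isLt.trans_le (Nat.le_pow_clog one_lt_two _)
  unfold SAF.adrK SAF.addrBit
  rw [Finset.sum_congr rfl (g := fun j => ((y.1 : ℕ).testBit j).toNat * 2 ^ j),
    sum_testBit_mul_two_pow, Nat.mod_eq_of_lt hlt, Nat.mod_eq_of_lt y.1.isLt]
  intro j hj
  have hj := Finset.mem_range.1 hj
  rw [bit_blockInput _ _ _ _ (by unfold SAF.addrLen at hL; omega), if_pos hj]

theorem adrW_blockInput {n K W : ℕ} (hL : SAF.addrLen K W ≤ SAF.blockLen n K W)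
    (e : Fin K × Fin (2 * W) ≃ Fin (2 * K * W))
    (T : Fin K × Fin (2 * W) → ℕ → Finset ℕ) (c : ℕ → ℕ → ℕ) (y : Fin K × Fin (2 * W)) :
    SAF.adrW K W (blockInput (n := n) e T c) (e y) = y.2 := by
  have hlt : (y.2 : ℕ) < 2 ^ Nat.clog 2 (2 * W) :=
    y.2.isLt.trans_le (Nat.le_pow_clog one_lt_two _)
  unfold SAF.adrW SAF.addrBit
  rw [Finset.sum_congr rfl (g := fun j => ((y.2 : ℕ).testBit j).toNat * 2 ^ j),
    sum_testBit_mul_two_pow, Nat.mod_eq_of_lt hlt, Nat.mod_eq_of_lt y.2.isLt]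
  intro j hj
  have hj := Finset.mem_range.1 hj
  rw [bit_blockInput _ _ _ _ (by unfold SAF.addrLen at hL; omega), if_neg (by omega),
    if_pos (by unfold SAF.addrLen; omega), Nat.add_sub_cancel]

theorem sum_valBit_blockInput {n K W : ℕ}
    (e : Fin K × Fin (2 * W) ≃ Fin (2 * K * W))
    (T : Fin K × Fin (2 * W) → ℕ → Finset ℕ) (c : ℕ → ℕ → ℕ) (y : Fin K × Fin (2 * W))
    (hT : T y (c y.1 y.2) ⊆ Finset.range (SAF.valLen n K W)) :
    ∑ j ∈ Finset.range (SAF.valLen n K W),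
      SAF.valBit K W (blockInput (n := n) e T c) (e y) j = (T y (c y.1 y.2)).card := by
  rw [Finset.sum_congr rfl (g := fun j => if j ∈ T y (c y.1 y.2) then 1 else 0),
    ← Finset.sum_filter, Finset.filter_mem_eq_inter, Finset.inter_eq_right.2 hT]
  · simp
  · intro j hj
    have hj := Finset.mem_range.1 hj
    unfold SAF.valLen at hj
    have h1 : Nat.clog 2 K ≤ SAF.addrLen K W := Nat.le_add_right _ _
    rw [SAF.valBit, add_assoc, bit_blockInput _ _ _ _ (by omega), if_neg (by omega),
      if_neg (by omega), Nat.add_sub_cancel_left]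
    split_ifs with h <;> simp [h]

/-! ### Cutting a variable order in the middle of the blocks -/

/-- Reading the elements of `N` disjoint blocks of `M ≥ W` elements one at a time, there is a moment
when exactly `H` of the blocks have at least `W` elements already read. Here `pos p j` is the time
when the element `j` of the block `p` is read. -/
theorem exists_cut {N M W H n : ℕ} (pos : ℕ → ℕ → ℕ) (hW : 0 < W) (hWM : W ≤ M) (hH : H ≤ N)
    (hpos : ∀ p < N, ∀ j < M, pos p j < n)
    (hinj : ∀ p < N, ∀ j < M, ∀ p' < N, ∀ j' < M, pos p j = pos p' j' → p = p') :
    ∃ u ≤ n, ((Finset.range N).filter fun p =>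
      W ≤ ((Finset.range M).filter fun j => pos p j < u).card).card = H := by
  set G : ℕ → Finset ℕ := fun u => (Finset.range N).filter fun p =>
      W ≤ ((Finset.range M).filter fun j => pos p j < u).card with hG
  have hGn : H ≤ (G n).card := by
    have : G n = Finset.range N := by
      refine Finset.filter_true_of_mem fun p hp => ?_
      rw [Finset.filter_true_of_mem fun j hj =>
        hpos p (Finset.mem_range.1 hp) j (Finset.mem_range.1 hj), Finset.card_range]
      exact hWM
    rw [this, Finset.card_range]
    exact hH
  have hG0 : (G 0).card = 0 := by
    rw [Finset.card_eq_zero]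
    refine Finset.filter_false_of_mem fun p _ => ?_
    simp
    omega
  have hGs : ∀ u, (G (u + 1)).card ≤ (G u).card + 1 := by
    intro u
    -- a block which becomes well read at time `u` contains the element that is read then
    have hnew : ∀ p ∈ G (u + 1) \ G u, p < N ∧ ∃ j < M, pos p j = u := by
      intro p hp
      simp only [hG, Finset.mem_sdiff, Finset.mem_filter, Finset.mem_range, not_and] at hp
      refine ⟨hp.1.1, ?_⟩
      by_contra! hcon
      apply hp.2 hp.1.1
      refine hp.1.2.trans (Finset.card_le_card fun j hj => ?_)
      simp only [Finset.mem_filter, Finset.mem_range] at hj ⊢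
      have := hcon j hj.1
      omega
    have h1 : (G (u + 1) \ G u).card ≤ 1 := by
      rw [Finset.card_le_one]
      intro p hp p' hp'
      obtain ⟨hN, j, hj, h⟩ := hnew p hp
      obtain ⟨hN', j', hj', h'⟩ := hnew p' hp'
      exact hinj p hN j hj p' hN' j' hj' (h.trans h'.symm)
    have := Finset.card_le_card_sdiff_add_card (s := G (u + 1)) (t := G u)
    omega
  have hex : ∃ u, H ≤ (G u).card := ⟨n, hGn⟩
  classical
  refine ⟨Nat.find hex, Nat.find_min' hex hGn, le_antisymm ?_ (Nat.find_spec hex)⟩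
  rcases Nat.eq_zero_or_pos (Nat.find hex) with h | h
  · change (G (Nat.find hex)).card ≤ H
    rw [h, hG0]
    exact Nat.zero_le _
  · obtain ⟨m, hm⟩ : ∃ m, Nat.find hex = m + 1 := ⟨Nat.find hex - 1, by omega⟩
    have h1 := Nat.find_min hex (m := m) (by omega)
    have h2 := hGs m
    change (G (Nat.find hex)).card ≤ H
    rw [hm]
    omega

theorem exists_equiv_iff {α β : Type*} [Fintype α] [Fintype β] (P : α → Prop) (Q : β → Prop)
    [DecidablePred P] [DecidablePred Q] (h : Fintype.card α = Fintype.card β)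
    (hPQ : Fintype.card {a // P a} = Fintype.card {b // Q b}) :
    ∃ e : α ≃ β, ∀ a, P a ↔ Q (e a) := by
  have hc : Fintype.card {a // ¬ P a} = Fintype.card {b // ¬ Q b} := by
    rw [Fintype.card_subtype_compl, Fintype.card_subtype_compl, h, hPQ]
  let e1 := Fintype.equivOfCardEq hPQ
  let e2 := Fintype.equivOfCardEq hc
  refine ⟨(Equiv.sumCompl P).symm.trans ((Equiv.sumCongr e1 e2).trans (Equiv.sumCompl Q)),
    fun a => ?_⟩
  by_cases ha : P a
  · simp [Equiv.sumCompl_symm_apply_of_pos ha, ha, (e1 ⟨a, ha⟩).2]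
  · simp [Equiv.sumCompl_symm_apply_of_neg ha, ha, (e2 ⟨a, ha⟩).2]

/-! ### Few layers and small width do not suffice for the shuffled address function -/

/-- The position in the variable order `π` of the value bit `j` of the block `p`. -/
def valPos {n : ℕ} (π : Equiv.Perm (Fin n)) (K W p j : ℕ) : ℕ :=
  if h : p * SAF.blockLen n K W + SAF.addrLen K W + j < n then
    π.symm ⟨p * SAF.blockLen n K W + SAF.addrLen K W + j, h⟩ else 0

/-- The value bits of the block `p` that are read in the first `u` steps (`early = True`) or after
them (`early = False`). -/
def valSide {n : ℕ} (π : Equiv.Perm (Fin n)) (K W u p : ℕ) (early : Prop)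
    [Decidable early] : Finset ℕ :=
  (Finset.range (SAF.valLen n K W)).filter fun j => valPos π K W p j < u ↔ early

/-- For every variable order there are a cut and a distribution of the addresses among the blocks
such that the blocks with an address below `W` have at least `W` value bits before the cut, and the
others at least `W` value bits after the cut. -/
theorem exists_addressing {n K W : ℕ} (π : Equiv.Perm (Fin n)) (hW : 0 < W)
    (hL : SAF.addrLen K W + 2 * W ≤ SAF.blockLen n K W) :
    ∃ u ≤ n, ∃ e : Fin K × Fin (2 * W) ≃ Fin (2 * K * W), ∀ y,
      W ≤ (valSide π K W u (e y) ((y.2 : ℕ) < W)).card := by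
  classical
  have hidx : ∀ p < 2 * K * W, ∀ j < SAF.valLen n K W,
      p * SAF.blockLen n K W + SAF.addrLen K W + j < n := by
    intro p hp j hj
    unfold SAF.valLen at hj
    rw [add_assoc]
    exact index_lt hp (by omega)
  obtain ⟨u, hu, hcard⟩ := exists_cut (N := 2 * K * W) (M := SAF.valLen n K W) (W := W)
    (H := K * W) (n := n) (valPos π K W) hW (by unfold SAF.valLen; omega)
    (by rw [mul_assoc]; omega)
    (fun p hp j hj => by rw [valPos, dif_pos (hidx p hp j hj)]; exact Fin.is_lt _)
    (fun p hp j hj p' hp' j' hj' h => by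
      rw [valPos, valPos, dif_pos (hidx p hp j hj), dif_pos (hidx p' hp' j' hj')] at h
      have h := congrArg Fin.val (π.symm.injective (Fin.ext h))
      simp only at h
      unfold SAF.valLen at hj hj'
      have e1 : (p * SAF.blockLen n K W + (SAF.addrLen K W + j)) / SAF.blockLen n K W = p := by
        rw [mul_comm, Nat.mul_add_div (by omega), Nat.div_eq_of_lt (by omega), add_zero]
      have e2 : (p' * SAF.blockLen n K W + (SAF.addrLen K W + j')) / SAF.blockLen n K W = p' := by
        rw [mul_comm, Nat.mul_add_div (by omega), Nat.div_eq_of_lt (by omega), add_zero]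
      rw [← e1, ← e2, ← add_assoc, ← add_assoc, h])
  set F : ℕ → Finset ℕ := fun p =>
    (Finset.range (SAF.valLen n K W)).filter fun j => valPos π K W p j < u with hF
  obtain ⟨e, he⟩ := exists_equiv_iff (α := Fin K × Fin (2 * W)) (β := Fin (2 * K * W))
    (fun y => (y.2 : ℕ) < W) (fun p => W ≤ (F p).card) (by simp; ring) (by
      rw [Fintype.card_subtype, Fintype.card_subtype]
      have h1 : (Finset.univ.filter fun p : Fin (2 * K * W) => W ≤ (F p).card).card = K * W := by
        rw [← hcard, ← Finset.card_map Fin.valEmbedding]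
        congr 1
        ext p
        simp only [Finset.mem_map, Finset.mem_filter, Finset.mem_univ, true_and,
          Fin.valEmbedding_apply, Finset.mem_range]
        constructor
        · rintro ⟨p, hp, rfl⟩
          exact ⟨p.isLt, hp⟩
        · rintro ⟨hp, h⟩
          exact ⟨⟨p, hp⟩, h, rfl⟩
      have h2 : (Finset.univ.filter fun y : Fin K × Fin (2 * W) => (y.2 : ℕ) < W) =
          Finset.univ ×ˢ (Finset.univ.filter fun i : Fin (2 * W) => (i : ℕ) < W) := by
        ext y; simp
      rw [h1, h2, Finset.card_product, Fin.card_filter_val_lt, Finset.card_univ, Fintype.card_fin,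
        min_eq_right (by omega)])
  refine ⟨u, hu, e, fun y => ?_⟩
  by_cases hy : (y.2 : ℕ) < W
  · have := (he y).1 hy
    simpa [valSide, hy, F] using this
  · have h1 : ¬ W ≤ (F (e y)).card := fun h => hy ((he y).2 h)
    have h2 := Finset.card_filter_add_card_filter_not (s := Finset.range (SAF.valLen n K W))
      (fun j => valPos π K W (e y) j < u)
    rw [Finset.card_range] at h2
    simp only [F] at h1
    simp only [valSide, hy, iff_false]
    have h3 : SAF.valLen n K W = SAF.blockLen n K W - SAF.addrLen K W := rfl
    omega

theorem blockInput_congr {n K W u : ℕ} {π : Equiv.Perm (Fin n)}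
    {e : Fin K × Fin (2 * W) ≃ Fin (2 * K * W)} {T : Fin K × Fin (2 * W) → ℕ → Finset ℕ}
    (hT : ∀ y, ∀ v < W, T y v ⊆ valSide π K W u (e y) ((y.2 : ℕ) < W)) {c c' : ℕ → ℕ → ℕ}
    (hc : ∀ t i, c t i < W) (hc' : ∀ t i, c' t i < W) (x : Fin n)
    (h : ∀ t i, ((π.symm x : ℕ) < u ↔ i < W) → c t i = c' t i) :
    blockInput e T c x = blockInput e T c' x := by
  unfold blockInput
  split_ifs with hx
  · extract_lets y q
    split_ifs with h1 h2
    · rfl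
    · rfl
    · by_cases hy : (π.symm x : ℕ) < u ↔ (y.2 : ℕ) < W
      · rw [h _ _ hy]
      · have hpos : valPos π K W (e y) (q - SAF.addrLen K W) = π.symm x := by
          have hey : (e y : ℕ) = x / SAF.blockLen n K W := by
            simp only [y, Equiv.apply_symm_apply]
          have hxe : (e y : ℕ) * SAF.blockLen n K W + SAF.addrLen K W + (q - SAF.addrLen K W) =
              x := by
            have := Nat.div_add_mod (x : ℕ) (SAF.blockLen n K W)
            rw [hey, mul_comm]
            omega
          rw [valPos, dif_pos (by rw [hxe]; exact x.isLt)]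
          simp only [hxe]
        have key : ∀ v < W, q - SAF.addrLen K W ∉ T y v := by
          intro v hv hmem
          have := (Finset.mem_filter.1 (hT y v hv hmem)).2
          rw [hpos] at this
          exact hy this
        simp [key _ (hc _ _), key _ (hc' _ _)]
  · rfl

/-- The values of the blocks whose addresses are below `W`: the addresses `0` and `1` keep their
names, and for a step `t + 1` the values at the addresses `i + 2` are free. -/
def freeVal {K W : ℕ} (a : Fin (K - 1) → Fin (W - 2) → Fin W) (t i : ℕ) : ℕ :=
  if h : 1 ≤ t ∧ t - 1 < K - 1 ∧ 2 ≤ i ∧ i - 2 < W - 2 then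
    a ⟨t - 1, h.2.1⟩ ⟨i - 2, h.2.2.2⟩ else min i 1

/-- The values of all blocks, composed of those with an address below `W` and the others. -/
def joinVal (W : ℕ) (a b : ℕ → ℕ → ℕ) (t i : ℕ) : ℕ := if i < W then a t i else b t (i - W)

theorem iterVal_joinVal_succ {W : ℕ} {a b : ℕ → ℕ → ℕ} {t : ℕ}
    (h : iterVal W (joinVal W a b) t < W) :
    iterVal W (joinVal W a b) (t + 1) = b t (a t (iterVal W (joinVal W a b) t)) := by
  rw [iterVal]
  simp [joinVal, h]

/-- The values steering the iteration to a given address before step `t`, testing there whether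
the value is `z`, and keeping the result of the test in the later steps. -/
def probeVal (t i z s y : ℕ) : ℕ :=
  if s < t then i else if s = t then (if y = z then 0 else 1) else min y 1

theorem iterVal_probe {K W t i z : ℕ} (hW : 2 ≤ W) (a : Fin (K - 1) → Fin (W - 2) → Fin W)
    (ht : 1 ≤ t) (hi : i < W) {m : ℕ} (hm : t < m) :
    iterVal W (joinVal W (freeVal a) (probeVal t i z)) m =
      if freeVal a t i = z then 0 else 1 := by
  have hlt : iterVal W (joinVal W (freeVal a) (probeVal t i z)) t = i := by
    obtain ⟨s, rfl⟩ : ∃ s, t = s + 1 := ⟨t - 1, by omega⟩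
    rw [iterVal]
    simp [joinVal, probeVal]
  induction m, Nat.succ_le_of_lt hm using Nat.le_induction with
  | base =>
    rw [Nat.succ_eq_add_one, iterVal_joinVal_succ (by rw [hlt]; exact hi), hlt]
    simp [probeVal]
  | succ m hm' ih =>
    have ih := ih (by omega)
    rw [iterVal_joinVal_succ (by rw [ih]; split_ifs <;> omega), ih]
    have h1 : ¬ m < t := by omega
    have h2 : ¬ m = t := by omega
    split_ifs <;> simp [probeVal, freeVal, h1, h2]

/-- A program for the shuffled address function has large width or many layers: at the cut of
`exists_addressing`, the values of `freeVal` can be told apart by the values of the other blocks. -/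
theorem pow_le_of_fn_mem {n K W k V : ℕ} (hW : 2 ≤ W)
    (hL : SAF.addrLen K W + 2 * W ≤ SAF.blockLen n K W)
    (h : SAF.fn (n := n) K W ∈ kNOBDDWidth k n V) :
    W ^ ((K - 1) * (W - 2)) ≤ 2 ^ (V ^ 2 * k) := by
  obtain ⟨π, hπ⟩ := exists_order_forall_card_le h
  obtain ⟨u, hu, e, he⟩ := exists_addressing (K := K) π (by omega : 0 < W) hL
  have hTex : ∀ y v, ∃ T : Finset ℕ, v < W →
      T ⊆ valSide π K W u (e y) ((y.2 : ℕ) < W) ∧ T.card = v := by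
    intro y v
    by_cases hv : v < W
    · obtain ⟨T, h1, h2⟩ := Finset.exists_subset_card_eq (hv.le.trans (he y))
      exact ⟨T, fun _ => ⟨h1, h2⟩⟩
    · exact ⟨∅, fun h => absurd h hv⟩
  choose T hT using hTex
  let c : (Fin (K - 1) → Fin (W - 2) → Fin W) → (ℕ → ℕ → Fin W) → ℕ → ℕ → ℕ := fun a b =>
    joinVal W (freeVal a) fun t i => b t i
  have hc : ∀ a b t i, c a b t i < W := by
    intro a b t i
    simp only [c, joinVal, freeVal]
    split_ifs
    · exact Fin.is_lt _
    · omega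
    · exact Fin.is_lt _
  have hfn : ∀ a b, SAF.fn K W (blockInput (n := n) e T (c a b)) =
      decide (0 < iterVal W (c a b) K) := by
    intro a b
    refine fn_eq_decide_iterVal (by omega) e (hc a b) (adrK_blockInput (by omega) _ _ _)
      (adrW_blockInput (by omega) _ _ _) fun y => ?_
    have hy := hT y _ (hc a b y.1 y.2)
    rw [sum_valBit_blockInput _ _ _ _ (hy.1.trans (Finset.filter_subset _ _)), hy.2,
      Nat.mod_eq_of_lt (hc a b _ _)]
  have := hπ u hu (Fin (K - 1) → Fin (W - 2) → Fin W) (ℕ → ℕ → Fin W)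
    (fun a b => blockInput e T (c a b))
    (fun a b b' x hx => blockInput_congr (fun y v hv => (hT y v hv).1) (hc a b) (hc a b') x
      fun t i hi => by simp [c, joinVal, hi.1 hx])
    (fun a a' b x hx => blockInput_congr (fun y v hv => (hT y v hv).1) (hc a b) (hc a' b) x
      fun t i hi => by
        have : ¬ i < W := fun h => by have := hi.2 h; omega
        simp [c, joinVal, this])
    (fun a a' hne => by
      obtain ⟨t, ht⟩ := Function.ne_iff.1 hne
      obtain ⟨i, hi⟩ := Function.ne_iff.1 ht
      have hfa : ∀ a : Fin (K - 1) → Fin (W - 2) → Fin W,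
          freeVal a (t + 1) (i + 2) = a t i := by
        intro a
        rw [freeVal, dif_pos ⟨by omega, by simp, by omega, by simp⟩]
        simp
      have hpv : ∀ s y, probeVal (t + 1) (i + 2) (a t i) s y < W := by
        intro s y
        have := i.isLt
        unfold probeVal
        split_ifs <;> omega
      have hKt : (t : ℕ) + 1 < K := by omega
      refine ⟨fun s y => ⟨_, hpv s y⟩, ?_⟩
      rw [hfn, hfn]
      simp only [c]
      rw [iterVal_probe hW a (by omega) (by omega) hKt,
        iterVal_probe hW a' (by omega) (by omega) hKt, hfa, hfa, if_pos rfl,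
        if_neg fun h => hi (Fin.ext h.symm)]
      simp)
  simpa [← pow_mul, mul_comm] using this

/-! ### A deterministic program for the shuffled address function -/

theorem sum_toNat_mul_two_pow_lt (B : ℕ → Bool) (m : ℕ) :
    ∑ j ∈ Finset.range m, (B j).toNat * 2 ^ j < 2 ^ m := by
  induction m with
  | zero => simp
  | succ m ih =>
    rw [Finset.sum_range_succ, pow_succ]
    have : (B m).toNat * 2 ^ m ≤ 1 * 2 ^ m := Nat.mul_le_mul_right _ (Bool.toNat_le _)
    omega

theorem testBit_sum_toNat_mul_two_pow (B : ℕ → Bool) {m j : ℕ} (hj : j < m) :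
    (∑ j ∈ Finset.range m, (B j).toNat * 2 ^ j).testBit j = B j := by
  induction m with
  | zero => omega
  | succ m ih =>
    rw [Finset.sum_range_succ, add_comm, mul_comm,
      Nat.testBit_two_pow_mul_add _ (sum_toNat_mul_two_pow_lt B m)]
    split_ifs with h
    · exact ih h
    · have : j = m := by omega
      subst this
      cases B j <;> simp

theorem two_pow_clog_lt {M : ℕ} (hM : 0 < M) : 2 ^ Nat.clog 2 M < 2 * M := by
  rcases Nat.lt_or_ge 1 M with h | h
  · have h1 := Nat.pow_pred_clog_lt_self (b := 2) one_lt_two h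
    have h2 : 0 < Nat.clog 2 M := Nat.clog_pos one_lt_two h
    obtain ⟨c, hc⟩ : ∃ c, Nat.clog 2 M = c + 1 := ⟨Nat.clog 2 M - 1, by omega⟩
    rw [hc] at h1 ⊢
    rw [pow_succ]
    simp only [Nat.pred_succ] at h1
    omega
  · have : M = 1 := by omega
    subst this
    simp

/-- A number of `Nat.clog 2 M` bits has the residue `t` modulo `M` if and only if its bits are those
of `t` or those of `t + M`. So the residue can be tested while the bits are read. -/
theorem sum_mod_eq_iff (B : ℕ → Bool) {M t : ℕ} (ht : t < M) :
    (∑ j ∈ Finset.range (Nat.clog 2 M), (B j).toNat * 2 ^ j) % M = t ↔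
      ∃ c : Bool, t + c.toNat * M < 2 ^ Nat.clog 2 M ∧
        ∀ j < Nat.clog 2 M, B j = (t + c.toNat * M).testBit j := by
  set S := ∑ j ∈ Finset.range (Nat.clog 2 M), (B j).toNat * 2 ^ j with hS
  have hlt : S < 2 ^ Nat.clog 2 M := sum_toNat_mul_two_pow_lt B _
  have h2 := two_pow_clog_lt (by omega : 0 < M)
  constructor
  · intro h
    have hc : ∃ c : Bool, t + c.toNat * M = S := by
      by_cases hSM : S < M
      · exact ⟨false, by rw [← h, Nat.mod_eq_of_lt hSM]; simp⟩
      · refine ⟨true, ?_⟩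
        rw [Nat.mod_eq_sub_mod (by omega), Nat.mod_eq_of_lt (by omega)] at h
        simp
        omega
    obtain ⟨c, hc⟩ := hc
    refine ⟨c, by omega, fun j hj => ?_⟩
    rw [hc, hS, testBit_sum_toNat_mul_two_pow B hj]
  · rintro ⟨c, hc, hB⟩
    have : S = t + c.toNat * M := by
      rw [hS, Finset.sum_congr rfl fun j hj => by rw [hB j (Finset.mem_range.1 hj)],
        sum_testBit_mul_two_pow, Nat.mod_eq_of_lt hc]
    rw [this, Nat.add_mul_mod_self_right, Nat.mod_eq_of_lt ht]

theorem bit_eq_readBit {n : ℕ} (x : Fin n → Bool) {i : ℕ} (hi : i < n) :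
    SAF.bit x i = (readBit 1 x i).toNat := by
  have hn : 0 < n := by omega
  simp [SAF.bit, readBit, hi, hn, Nat.mod_eq_of_lt hi]

namespace Lookup

/-- The four strings of address bits that encode the step `t` and the address `i` are indexed by
pairs of Booleans, which say whether `t` or `t + K`, and `i` or `i + 2W`, is written in binary. -/
def codeBit (K W t i : ℕ) (c : Bool × Bool) (j : ℕ) : Bool :=
  if j < Nat.clog 2 K then (t + c.1.toNat * K).testBit j
  else (i + c.2.toNat * (2 * W)).testBit (j - Nat.clog 2 K)

/-- The numbers `t + K` and `i + 2W` may need too many bits. -/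
def codeValid (K W t i : ℕ) (c : Bool × Bool) : Prop :=
  t + c.1.toNat * K < 2 ^ Nat.clog 2 K ∧ i + c.2.toNat * (2 * W) < 2 ^ Nat.clog 2 (2 * W)

instance (K W t i : ℕ) (c : Bool × Bool) : Decidable (codeValid K W t i c) :=
  inferInstanceAs (Decidable (_ ∧ _))

variable {n : ℕ} (K W : ℕ) (x : Fin n → Bool)

/-- Which of the four codes agree with the first `q` bits of the block `p`. -/
def flags (t i p q : ℕ) (c : Bool × Bool) : Bool :=
  decide (codeValid K W t i c ∧
    ∀ j < q, readBit 1 x (p * SAF.blockLen n K W + j) = codeBit K W t i c j)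

/-- The block `p` has the step number `t` and the address `i`. -/
def hit (t i p : ℕ) : Bool := decide (SAF.adrK K W x p = t ∧ SAF.adrW K W x p = i)

/-- The sum modulo `W` of the first `q` value bits of the block `p`. -/
def partVal (p q : ℕ) : ℕ := (∑ j ∈ Finset.range q, SAF.valBit K W x p j) % W

variable {K W x}

theorem flags_zero {t i p : ℕ} :
    flags K W x t i p 0 = fun c => decide (codeValid K W t i c) := by
  funext c
  simp [flags]

theorem hit_eq_true_iff {t i p : ℕ} (hL : SAF.addrLen K W ≤ SAF.blockLen n K W)
    (hp : p < 2 * K * W) (ht : t < K) (hi : i < 2 * W) :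
    hit K W x t i p = true ↔ ∃ c, flags K W x t i p (SAF.addrLen K W) c = true := by
  have hA : SAF.addrLen K W = Nat.clog 2 K + Nat.clog 2 (2 * W) := rfl
  have hbit : ∀ j < SAF.addrLen K W,
      SAF.addrBit K W x p j = (readBit 1 x (p * SAF.blockLen n K W + j)).toNat := fun j hj =>
    bit_eq_readBit x (index_lt hp (by omega))
  have h1 : SAF.adrK K W x p = t ↔ _ :=
    (by
      unfold SAF.adrK
      rw [Finset.sum_congr rfl fun j hj => by
        rw [hbit j (by have := Finset.mem_range.1 hj; omega)]] :
      SAF.adrK K W x p = t ↔ (∑ j ∈ Finset.range (Nat.clog 2 K),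
        (readBit 1 x (p * SAF.blockLen n K W + j)).toNat * 2 ^ j) % K = t).trans
      (sum_mod_eq_iff (fun j => readBit 1 x (p * SAF.blockLen n K W + j)) ht)
  have h2 : SAF.adrW K W x p = i ↔ _ :=
    (by
      unfold SAF.adrW
      rw [Finset.sum_congr rfl fun j hj => by
        rw [hbit _ (by have := Finset.mem_range.1 hj; omega)]] :
      SAF.adrW K W x p = i ↔ (∑ j ∈ Finset.range (Nat.clog 2 (2 * W)),
        (readBit 1 x (p * SAF.blockLen n K W + (j + Nat.clog 2 K))).toNat * 2 ^ j) % (2 * W)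
          = i).trans
      (sum_mod_eq_iff (fun j => readBit 1 x (p * SAF.blockLen n K W + (j + Nat.clog 2 K))) hi)
  have h3 : hit K W x t i p = true ↔ SAF.adrK K W x p = t ∧ SAF.adrW K W x p = i := by
    unfold hit
    exact decide_eq_true_iff
  have h4 : ∀ c, flags K W x t i p (SAF.addrLen K W) c = true ↔ codeValid K W t i c ∧
      ∀ j < SAF.addrLen K W, readBit 1 x (p * SAF.blockLen n K W + j) = codeBit K W t i c j :=
    fun c => by
      unfold flags
      exact decide_eq_true_iff
  simp only [h3, h4, h1, h2, codeValid]
  constructor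
  · rintro ⟨⟨c, hc, hcb⟩, d, hd, hdb⟩
    refine ⟨(c, d), ⟨hc, hd⟩, fun j hj => ?_⟩
    unfold codeBit
    split_ifs with h
    · exact hcb j h
    · have := hdb (j - Nat.clog 2 K) (by omega)
      rwa [Nat.sub_add_cancel (by omega)] at this
  · rintro ⟨⟨c, d⟩, ⟨hc, hd⟩, hb⟩
    refine ⟨⟨c, hc, fun j hj => ?_⟩, d, hd, fun j hj => ?_⟩
    · have := hb j (by omega)
      rwa [codeBit, if_pos hj] at this
    · have := hb (j + Nat.clog 2 K) (by omega)
      rwa [codeBit, if_neg (by omega), Nat.add_sub_cancel] at this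

/-- A state of the search for the block with a given address: there is no address to look for
(`none`), the search goes on (`Sum.inl`, with the address and the codes that agree with the current
block), or the block is found (`Sum.inr`, with the value read so far and whether the
current block is still this one). -/
abbrev State : Type := Option ((ℕ × (Bool × Bool → Bool)) ⊕ (ℕ × Bool))

variable (K W x)

/-- The state after `q` bits of the block `p`, in the search for the address `s` of step `t`. -/
def blockState (t : ℕ) (s : Option ℕ) (p q : ℕ) : State :=
  s.bind fun i => match (List.range p).find? (hit K W x t i) with
    | some p' => some (Sum.inr (partVal K W x p' (SAF.valLen n K W), false))
    | none =>
      if q ≤ SAF.addrLen K W then some (Sum.inl (i, flags K W x t i p q))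
      else if hit K W x t i p then some (Sum.inr (partVal K W x p (q - SAF.addrLen K W), true))
      else some (Sum.inl (i, fun _ => false))

/-- The effect of the bit `b` read at the offset `q` of a block. -/
def stepBit (t q : ℕ) (b : Bool) : State → State
  | none => none
  | some (Sum.inr (v, r)) => some (Sum.inr (if r then (v + b.toNat) % W else v, r))
  | some (Sum.inl (i, F)) =>
    if q < SAF.addrLen K W then some (Sum.inl (i, fun c => F c && (b == codeBit K W t i c q)))
    else if q = SAF.addrLen K W ∧ ∃ c, F c = true then some (Sum.inr (b.toNat % W, true))
    else some (Sum.inl (i, fun _ => false))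

/-- The effect of the end of a block. -/
def closeBlock (t : ℕ) : State → State
  | none => none
  | some (Sum.inr (v, _)) => some (Sum.inr (v, false))
  | some (Sum.inl (i, _)) => some (Sum.inl (i, fun c => decide (codeValid K W t i c)))

variable {K W}

theorem blockState_succ {t p q : ℕ} {s : Option ℕ} (hp : p < 2 * K * W)
    (hq : q < SAF.blockLen n K W) (hL : SAF.addrLen K W ≤ SAF.blockLen n K W) (ht : t < K)
    (hs : ∀ i ∈ s, i < 2 * W) :
    blockState K W x t s p (q + 1) =
      stepBit K W t q (readBit 1 x (p * SAF.blockLen n K W + q)) (blockState K W x t s p q) := by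
  cases s with
  | none => rfl
  | some i =>
    have hi := hs i rfl
    simp only [blockState, Option.bind_some]
    cases hfind : (List.range p).find? (hit K W x t i) with
    | some p' => simp [stepBit]
    | none =>
      simp only
      have hit_iff := hit_eq_true_iff (x := x) hL hp ht hi
      have hpart : ∀ d, q = SAF.addrLen K W + d →
          SAF.valBit K W x p d = (readBit 1 x (p * SAF.blockLen n K W + q)).toNat := by
        rintro d rfl
        rw [SAF.valBit, add_assoc, bit_eq_readBit _ (index_lt hp hq)]
      rcases lt_trichotomy q (SAF.addrLen K W) with h | h | h
      · rw [if_pos (by omega : q + 1 ≤ _), if_pos h.le]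
        simp only [stepBit, h, if_true]
        congr 3
        funext c
        rw [Bool.eq_iff_iff]
        simp only [flags, Nat.forall_lt_succ_right, Bool.and_eq_true, decide_eq_true_eq, beq_iff_eq,
          and_assoc]
      · rw [if_neg (by omega : ¬ q + 1 ≤ _), if_pos h.le]
        simp only [stepBit, h, lt_irrefl, if_false, true_and, hit_iff]
        split_ifs with hc
        · have := hpart 0 h
          simp [partVal, this, ← h]
        · rfl
      · rw [if_neg (by omega : ¬ q + 1 ≤ _), if_neg (by omega : ¬ q ≤ _)]
        split_ifs with hh
        · obtain ⟨d, rfl⟩ : ∃ d, q = SAF.addrLen K W + d := ⟨q - SAF.addrLen K W, by omega⟩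
          simp only [stepBit, if_true, partVal]
          rw [add_assoc, Nat.add_sub_cancel_left, Nat.add_sub_cancel_left, Finset.sum_range_succ,
            hpart d rfl, Nat.mod_add_mod]
        · simp [stepBit, h.not_gt]

theorem blockState_close {t p : ℕ} {s : Option ℕ} (hL : SAF.addrLen K W < SAF.blockLen n K W) :
    blockState K W x t s (p + 1) 0 =
      closeBlock K W t (blockState K W x t s p (SAF.blockLen n K W)) := by
  cases s with
  | none => rfl
  | some i =>
    simp only [blockState, Option.bind_some, List.range_succ, List.find?_append, zero_le, if_true]
    cases hfind : (List.range p).find? (hit K W x t i) with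
    | some p' => simp [closeBlock]
    | none =>
      simp only [Option.none_or, not_le.2 hL, if_false, List.find?_singleton]
      by_cases hh : hit K W x t i p = true
      · simp [hh, closeBlock, SAF.valLen]
      · simp only [hh]
        simp [closeBlock, flags_zero]

variable (K W)

/-- The state after `m` bits of a layer; the bits behind the last block are ignored. -/
def layerState (t : ℕ) (s : Option ℕ) (m : ℕ) : State :=
  if m < 2 * K * W * SAF.blockLen n K W then
    blockState K W x t s (m / SAF.blockLen n K W) (m % SAF.blockLen n K W)
  else blockState K W x t s (2 * K * W) 0

/-- The effect of the bit `b` read in step `m` of a layer of `n` steps. -/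
def stepLayer (n t m : ℕ) (b : Bool) (a : State) : State :=
  if m < 2 * K * W * SAF.blockLen n K W then
    if m % SAF.blockLen n K W + 1 < SAF.blockLen n K W then
      stepBit K W t (m % SAF.blockLen n K W) b a
    else closeBlock K W t (stepBit K W t (m % SAF.blockLen n K W) b a)
  else a

variable {K W}

theorem layerState_succ {t m : ℕ} {s : Option ℕ} (hL : SAF.addrLen K W < SAF.blockLen n K W)
    (ht : t < K) (hs : ∀ i ∈ s, i < 2 * W) :
    layerState K W x t s (m + 1) =
      stepLayer K W n t m (readBit 1 x m) (layerState K W x t s m) := by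
  set L := SAF.blockLen n K W with hLdef
  unfold layerState stepLayer
  rw [← hLdef]
  by_cases hm : m < 2 * K * W * L
  · have hL0 : 0 < L := by omega
    have hp : m / L < 2 * K * W := Nat.div_lt_of_lt_mul (by rwa [mul_comm])
    have hq := Nat.mod_lt m hL0
    have hmeq : m / L * L + m % L = m := by rw [mul_comm]; exact Nat.div_add_mod m L
    have hstep := blockState_succ x hp hq hL.le ht hs
    rw [← hLdef, hmeq] at hstep
    simp only [hm, if_true]
    rw [← hstep]
    by_cases hlast : m % L + 1 < L
    · have h1 : (m + 1) / L = m / L := by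
        rw [← hmeq, add_assoc, mul_comm, Nat.mul_add_div hL0, Nat.mul_add_div hL0,
          Nat.div_eq_of_lt hlast, Nat.div_eq_of_lt hq]
      have h2 : (m + 1) % L = m % L + 1 := by
        conv_lhs => rw [← hmeq, add_assoc, mul_comm, Nat.mul_add_mod, Nat.mod_eq_of_lt hlast]
      have h3 : m + 1 < 2 * K * W * L := by
        have : (m / L + 1) * L ≤ 2 * K * W * L := Nat.mul_le_mul_right _ hp
        rw [Nat.succ_mul] at this
        omega
      rw [if_pos h3, if_pos hlast, h1, h2]
    · have h4 : m % L + 1 = L := by omega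
      have h5 : m + 1 = (m / L + 1) * L := by rw [Nat.succ_mul]; omega
      have h1 : (m + 1) / L = m / L + 1 := by rw [h5, Nat.mul_div_cancel _ hL0]
      have h2 : (m + 1) % L = 0 := by rw [h5, Nat.mul_mod_left]
      rw [if_neg hlast, h4, ← blockState_close x hL, h1, h2]
      split_ifs with h3
      · rfl
      · have : 2 * K * W ≤ m / L + 1 :=
          Nat.le_of_mul_le_mul_right (by rw [← h5]; omega) hL0
        rw [show 2 * K * W = m / L + 1 by omega]
  · have hm' : ¬ m + 1 < 2 * K * W * L := by omega
    simp only [hm, hm', if_false]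

/-- The value found by a search, if it was successful. -/
def State.result : State → Option ℕ
  | some (Sum.inr (v, _)) => some v
  | _ => none

theorem result_blockState {t : ℕ} {s : Option ℕ} :
    (blockState K W x t s (2 * K * W) 0).result = s.bind fun i => SAF.val K W x i t := by
  cases s with
  | none => rfl
  | some i =>
    simp only [blockState, Option.bind_some, SAF.val, SAF.ind]
    change _ = ((List.range (2 * K * W)).find? (hit K W x t i)).map _
    cases hfind : (List.range (2 * K * W)).find? (hit K W x t i) with
    | some p' => rfl
    | none => simp [State.result]

variable (K W)

/-- The address that is searched for in the layer `l`, which belongs to the step `l / 2`. -/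
def query : ℕ → Option ℕ
  | 0 => some 0
  | l + 1 => ((query l).bind fun i => SAF.val K W x i (l / 2)).map
      fun v => if l % 2 = 0 then v + W else v

variable {K W}

theorem query_two_mul (t : ℕ) : query K W x (2 * t) = SAF.step2 K W x t := by
  induction t with
  | zero => rfl
  | succ t ih =>
    have h1 : 2 * t % 2 = 0 := by omega
    have h2 : 2 * t / 2 = t := by omega
    have h3 : (2 * t + 1) % 2 = 1 := by omega
    have h4 : (2 * t + 1) / 2 = t := by omega
    rw [Nat.mul_succ, query, query, ih, h1, h2, h3, h4, SAF.step2, SAF.step1]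
    simp

theorem query_lt (hW : 0 < W) (l : ℕ) : ∀ i ∈ query K W x l, i < 2 * W := by
  cases l with
  | zero =>
    intro i hi
    have : i = 0 := by simpa [query] using hi.symm
    omega
  | succ l =>
    intro i hi
    simp only [query, Option.mem_def, Option.map_eq_some_iff, Option.bind_eq_some_iff,
      SAF.val] at hi
    obtain ⟨v, ⟨_, _, p, _, hv⟩, rfl⟩ := hi
    have : v < W := by rw [← hv]; exact Nat.mod_lt _ hW
    split_ifs <;> omega

variable (K W) in
/-- The states with an address below `2W` or a value below `W`. -/
def states : Finset State :=
  Finset.insertNone ((Finset.range (2 * W) ×ˢ Finset.univ).disjSum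
    (Finset.range W ×ˢ Finset.univ))

theorem card_states : (states W).card = 34 * W + 1 := by
  simp [states, Finset.card_disjSum]
  omega

theorem blockState_mem (hW : 0 < W) {t p q : ℕ} {s : Option ℕ} (hs : ∀ i ∈ s, i < 2 * W) :
    blockState K W x t s p q ∈ states W := by
  cases s with
  | none => simp [states, blockState]
  | some i =>
    have hi := hs i rfl
    have hv : ∀ p q, partVal K W x p q < W := fun p q => Nat.mod_lt _ hW
    simp only [blockState, Option.bind_some]
    cases hfind : (List.range p).find? (hit K W x t i) with
    | some p' => simp [states, hv]
    | none =>
      simp only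
      split_ifs <;> simp [states, hv, hi]

/-- The program has two layers for each step, one for each look-up. -/
theorem fn_mem_kNOBDDWidth (hW : 0 < W) (hL : SAF.addrLen K W < SAF.blockLen n K W) :
    SAF.fn (n := n) K W ∈ kNOBDDWidth (2 * K) n (34 * W + 2) := by
  rcases Nat.eq_zero_or_pos K with rfl | hK
  · have : SAF.fn (n := n) 0 W = fun _ => false := by
      funext x
      simp [SAF.fn, SAF.step2]
    rw [this, mem_kNOBDDWidth_iff]
    refine ⟨1, fun _ _ _ _ => False, 0, 1, by omega, by omega, fun σ => ?_⟩
    simp only [Bool.false_eq_true, false_iff]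
    rintro ⟨p, h0, h1, -⟩
    simp only [mul_zero, zero_mul] at h1
    omega
  have hNL : 2 * K * W * SAF.blockLen n K W ≤ n := Nat.mul_div_le _ _
  have hNL0 : 0 < 2 * K * W * SAF.blockLen n K W := by
    have : 0 < SAF.blockLen n K W := by omega
    positivity
  have hn : 0 < n := by omega
  have h00 : ∀ x : Fin n → Bool, ∀ t s, layerState K W x t s 0 =
      s.map fun i => Sum.inl (i, fun c => decide (codeValid K W t i c)) := by
    intro x t s
    rw [layerState, if_pos hNL0, Nat.zero_div, Nat.zero_mod]
    cases s with
    | none => rfl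
    | some i => simp [blockState, flags_zero]
  have hdiv : ∀ j, j / n * n + j % n = j := fun j => by rw [mul_comm]; exact Nat.div_add_mod j n
  have hmem : ∀ x : Fin n → Bool, ∀ t l m, layerState K W x t (query K W x l) m ∈ states W := by
    intro x t l m
    unfold layerState
    split_ifs <;> exact blockState_mem x hW (query_lt x hW l)
  have hcard : 34 * W + 2 = (states W).card + 1 := by rw [card_states]
  rw [hcard]
  refine mem_kNOBDDWidth_of_state (states W)
    (fun j x => layerState K W x (j / n / 2) (query K W x (j / n)) (j % n))
    (fun _ _ _ => hmem _ _ _ _) (fun x y => ?_) (fun j hj x y hxy hb => ?_) (fun x y hxy => ?_)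
  · simp only [Nat.zero_div, Nat.zero_mod, h00]
    rfl
  · have hl : j / n < 2 * K := Nat.div_lt_of_lt_mul (by rwa [mul_comm])
    have hm := Nat.mod_lt j hn
    have hrb : ∀ z : Fin n → Bool, readBit 1 z (j % n) = readBit 1 z j := by
      intro z
      simp [readBit]
    have hnext : layerState K W x (j / n / 2) (query K W x (j / n)) (j % n + 1) =
        layerState K W y (j / n / 2) (query K W y (j / n)) (j % n + 1) := by
      rw [layerState_succ x hL (by omega) (query_lt x hW _),
        layerState_succ y hL (by omega) (query_lt y hW _), hrb, hrb, hb, hxy]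
    by_cases hlast : j % n + 1 < n
    · have h1 : (j + 1) / n = j / n := by
        conv_lhs => rw [← hdiv j, add_assoc, mul_comm, Nat.mul_add_div hn, Nat.div_eq_of_lt hlast,
          add_zero]
      have h2 : (j + 1) % n = j % n + 1 := by
        conv_lhs => rw [← hdiv j, add_assoc, mul_comm, Nat.mul_add_mod, Nat.mod_eq_of_lt hlast]
      simp only [h1, h2]
      exact hnext
    · have h4 : j % n + 1 = n := by omega
      have h5 : j + 1 = (j / n + 1) * n := by
        rw [Nat.succ_mul]
        have := hdiv j
        omega
      have h1 : (j + 1) / n = j / n + 1 := by rw [h5, Nat.mul_div_cancel _ hn]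
      have h2 : (j + 1) % n = 0 := by rw [h5, Nat.mul_mod_left]
      rw [h4, layerState, layerState, if_neg (by omega), if_neg (by omega)] at hnext
      have hres := congrArg State.result hnext
      rw [result_blockState, result_blockState] at hres
      simp only [h1, h2, h00, query, hres]
  · rw [Nat.mul_div_cancel _ hn, Nat.mul_mod_left, h00, h00, query_two_mul, query_two_mul] at hxy
    have : SAF.step2 K W x K = SAF.step2 K W y K := by
      cases h1 : SAF.step2 K W x K <;> cases h2 : SAF.step2 K W y K <;> simp_all
    rw [SAF.fn, SAF.fn, this]

end Lookup

/-! ### Many functions with programs of small width -/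

namespace Pair

/-- A program for `pairFn` reads, in the layer `l`, the variables of the first half with the
indices in `[l * m, (l + 1) * m)`, and remembers the last one that is `1` (`some (some c)` for the
index `l * m + c`). It accepts (`none`) if in the same layer a variable `h + i` of the second half
is `1` and `A (l * m + c) i` holds. This is the effect of the bit `b` read at the position `j`. -/
def step (h m : ℕ) (A : ℕ → ℕ → Bool) (l j : ℕ) (b : Bool) : Option (Option ℕ) → Option (Option ℕ)
  | none => none
  | some s =>
    if j < h then
      some (if b = true ∧ l * m ≤ j ∧ j < l * m + m then some (j - l * m)
        else if j = 0 then none else s)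
    else if b = true ∧ ∃ c ∈ s, A (l * m + c) (j - h) = true then none else some s

variable {n : ℕ}

/-- The state after the first `r` steps of the program for `pairFn`. -/
def run (m : ℕ) (A : ℕ → ℕ → Bool) (x : Fin n → Bool) : ℕ → Option (Option ℕ)
  | 0 => some none
  | r + 1 => step (n / 2) m A (r / n) (r % n) (readBit 1 x r) (run m A x r)

/-- For some layer `l < k` the last variable with index in `[l * m, (l + 1) * m)` that is `1` and
some variable of the second half that is `1` form a pair allowed by the matrix `A`. -/
def pairFn (k m : ℕ) (A : ℕ → ℕ → Bool) (x : Fin n → Bool) : Bool := (run m A x (k * n)).isNone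

theorem pairFn_mem (k m : ℕ) (A : ℕ → ℕ → Bool) :
    pairFn (n := n) k m A ∈ kNOBDDWidth k n (m + 3) := by
  have hcard : m + 3 = (Finset.insertNone (Finset.insertNone (Finset.range m))).card + 1 := by
    simp
  rw [hcard]
  refine mem_kNOBDDWidth_of_state _ (fun j x => run m A x j) (fun j _ x => ?_) (fun _ _ => rfl)
    (fun j _ x y hxy hb => ?_) (fun x y hxy => ?_)
  · induction j with
    | zero => simp [run]
    | succ j ih =>
      have ih := ih (by omega)
      rw [run]
      generalize run m A x j = a at ih
      cases a with
      | none => simp [step]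
      | some s =>
        simp only [step]
        split_ifs
        · simp
          omega
        · simp
        · exact ih
        · simp
        · exact ih
  · simp only [run] at hxy ⊢
    rw [hxy, hb]
  · simp only [pairFn]
    rw [hxy]

/-- On the input whose only ones are the variables `t` and `n / 2 + i`, the value is `A t i`. -/
theorem pairFn_eq {k m t i : ℕ} (A : ℕ → ℕ → Bool) (hkm : k * m ≤ n / 2) (ht : t < k * m)
    (hi : i < n / 2) :
    pairFn k m A (fun x : Fin n => decide ((x : ℕ) = t ∨ (x : ℕ) = n / 2 + i)) = A t i := by
  set x := fun x : Fin n => decide ((x : ℕ) = t ∨ (x : ℕ) = n / 2 + i) with hx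
  set h := n / 2 with hh
  have hn : 0 < n := by omega
  have hm : 0 < m := Nat.pos_of_ne_zero fun h0 => by simp [h0] at ht
  set T := t / m with hT
  have hTk : T < k := Nat.div_lt_of_lt_mul (by rwa [mul_comm])
  have htm : T * m + t % m = t := by rw [mul_comm]; exact Nat.div_add_mod t m
  have htmlt := Nat.mod_lt t hm
  clear_value T h
  have key : ∀ r, run m A x r = if A t i = true ∧ T * n + h + i < r then none else
      if T * n + t < r ∧ r ≤ T * n + n then some (some (t % m)) else some none := by
    intro r
    induction r with
    | zero => simp [run]
    | succ r ih =>
      rw [run, ih, ← hh]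
      have hr : r / n * n + r % n = r := by rw [mul_comm]; exact Nat.div_add_mod r n
      have hjn := Nat.mod_lt r hn
      have hb : readBit 1 x r = decide (r % n = t ∨ r % n = h + i) := by
        simp [readBit, hn, hx]
      rw [hb]
      generalize r / n = l at *
      generalize r % n = j at *
      rcases lt_trichotomy l T with hl | rfl | hl
      · have h1 : l * n + n ≤ T * n := by
          rw [← Nat.succ_mul]; exact Nat.mul_le_mul_right _ hl
        have h2 : l * m + m ≤ T * m := by
          rw [← Nat.succ_mul]; exact Nat.mul_le_mul_right _ hl
        rw [if_neg (by omega), if_neg (by omega), if_neg (by omega), if_neg (by omega)]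
        simp only [step, decide_eq_true_eq, Option.mem_def, reduceCtorEq, false_and, exists_false,
          and_false, if_false]
        rw [if_neg (c := (j = t ∨ j = h + i) ∧ _) (by omega)]
        split_ifs <;> rfl
      · by_cases hA : A t i = true ∧ l * n + h + i < r
        · rw [if_pos hA, if_pos ⟨hA.1, by omega⟩]
          rfl
        · rw [if_neg hA]
          rcases lt_trichotomy j t with hjt | rfl | hjt
          · rw [if_neg (by omega), if_neg (by omega), if_neg (by omega)]
            simp only [step]
            rw [if_pos (by omega)]
            simp only [decide_eq_true_eq]
            rw [if_neg (by omega)]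
            split_ifs <;> rfl
          · rw [if_neg (by omega), if_neg (by omega), if_pos (by omega)]
            simp only [step]
            rw [if_pos (by omega), if_pos ⟨by simp, by omega, by omega⟩]
            congr 2
            omega
          · rw [if_pos (c := l * n + t < r ∧ _) (by omega),
              if_pos (c := l * n + t < r + 1 ∧ _) (by omega)]
            have hstep : step h m A l j (decide (j = t ∨ j = h + i)) (some (some (t % m))) =
                if A t i = true ∧ j = h + i then none else some (some (t % m)) := by
              by_cases hjh : j < h
              · simp only [step, decide_eq_true_eq]
                rw [if_pos hjh, if_neg (by omega), if_neg (by omega), if_neg (by omega)]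
              · simp only [step, decide_eq_true_eq, Option.mem_some_iff, exists_eq_left', htm]
                rw [if_neg hjh]
                refine if_congr ⟨?_, ?_⟩ rfl rfl
                · rintro ⟨h1, h2⟩
                  obtain rfl : j = h + i := by omega
                  rw [Nat.add_sub_cancel_left] at h2
                  exact ⟨h2, rfl⟩
                · rintro ⟨h1, rfl⟩
                  rw [Nat.add_sub_cancel_left]
                  exact ⟨Or.inr rfl, h1⟩
            rw [hstep]
            exact if_congr (and_congr_right fun h1 =>
              ⟨fun h2 => by omega, fun h2 => by
                have : ¬ l * n + h + i < r := fun h3 => hA ⟨h1, h3⟩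
                omega⟩) rfl rfl
      · have h1 : T * n + n ≤ l * n := by
          rw [← Nat.succ_mul]; exact Nat.mul_le_mul_right _ hl
        have h2 : T * m + m ≤ l * m := by
          rw [← Nat.succ_mul]; exact Nat.mul_le_mul_right _ hl
        by_cases hA : A t i = true
        · rw [if_pos ⟨hA, by omega⟩, if_pos ⟨hA, by omega⟩]
          rfl
        · rw [if_neg (c := A t i = true ∧ T * n + h + i < r) fun h => hA h.1,
            if_neg (c := A t i = true ∧ T * n + h + i < r + 1) fun h => hA h.1,
            if_neg (c := T * n + t < r + 1 ∧ _) (by omega)]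
          by_cases hj0 : j = 0
          · have hreset : ∀ o, step h m A l j (decide (j = t ∨ j = h + i)) (some o) = some none := by
              intro o
              simp only [step, decide_eq_true_eq]
              rw [if_pos (by omega), if_neg (by omega), if_pos hj0]
            split_ifs <;> exact hreset _
          · rw [if_neg (c := T * n + t < r ∧ _) (by omega)]
            have hidle : ¬ ((j = t ∨ j = h + i) ∧ l * m ≤ j ∧ j < l * m + m ∧ j < h) := by omega
            simp only [step, decide_eq_true_eq]
            split_ifs with c1 c2 c3
            · exact absurd ⟨c2.1, c2.2.1, c2.2.2, c1⟩ hidle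
            · rfl
            · simp at c3
            · rfl
  have h1 : (T + 1) * n ≤ k * n := Nat.mul_le_mul_right _ hTk
  rw [Nat.succ_mul] at h1
  rw [pairFn, key]
  by_cases hA : A t i = true
  · rw [if_pos ⟨hA, by omega⟩, hA]
    rfl
  · rw [if_neg fun h => hA h.1]
    rw [Bool.not_eq_true] at hA
    rw [hA]
    split_ifs <;> rfl

end Pair

/-! ### Counting programs -/

/-- A program with `k` layers and nodes below `V` is given by its order, the edges, the source and
the sink. So a larger family of distinct functions contains one without such a program. -/
theorem exists_notMem_kNOBDDWidth {α : Type*} [Fintype α] {n k V : ℕ}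
    (φ : α → (Fin n → Bool) → Bool) (hφ : Function.Injective φ)
    (hcard : n.factorial * (2 ^ (2 * (V ^ 2 * k) * n) * V ^ 2) < Fintype.card α) :
    ∃ a, φ a ∉ kNOBDDWidth k n V := by
  classical
  by_contra! hall
  simp only [mem_kNOBDDWidth_iff] at hall
  choose π E s t hs ht h using hall
  let D : α → Equiv.Perm (Fin n) × (Fin (k * n) → Bool → Fin V → Fin V → Prop) × Fin V × Fin V :=
    fun a => (π a, fun j b u v => E a j b u v, ⟨s a, hs a⟩, ⟨t a, ht a⟩)
  have hD : Function.Injective D := by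
    intro a a' haa
    simp only [D, Prod.mk.injEq, Fin.mk.injEq] at haa
    obtain ⟨h1, h2, h3, h4⟩ := haa
    apply hφ
    funext σ
    rw [Bool.eq_iff_iff, h, h, h1, h3, h4]
    refine exists_congr fun p => and_congr_right fun _ => and_congr_right fun _ =>
      and_congr_right fun hV => forall₂_congr fun j hj => iff_of_eq ?_
    exact congrFun (congrFun (congrFun (congrFun h2 ⟨j, hj⟩) _) ⟨p j, hV j hj.le⟩)
      ⟨p (j + 1), hV (j + 1) hj⟩
  refine absurd (Fintype.card_le_of_injective D hD) (not_le.2 (lt_of_eq_of_lt ?_ hcard))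
  simp only [Fintype.card_prod, Fintype.card_perm, Fintype.card_fun, Fintype.card_prop,
    Fintype.card_fin, Fintype.card_bool]
  rw [← pow_mul, ← pow_mul, ← pow_mul]
  congr 1
  ring_nf

/-- A program without layers computes a constant. -/
theorem kNOBDDWidth_zero_subset (n V : ℕ) : kNOBDDWidth 0 n V ⊆ kNOBDDWidth 0 n 2 := by
  intro f hf
  rw [mem_kNOBDDWidth_iff] at hf ⊢
  obtain ⟨π, E, s, t, hs, ht, h⟩ := hf
  refine ⟨π, E, 0, if s = t then 0 else 1, by omega, by split_ifs <;> omega, fun σ => ?_⟩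
  rw [h]
  simp only [WalkAccepts, zero_mul, Nat.not_lt_zero, false_imp_iff, implies_true, and_true,
    nonpos_iff_eq_zero, forall_eq]
  constructor
  · rintro ⟨p, h0, h1, -⟩
    exact ⟨fun _ => 0, rfl, by simp [← h0, ← h1], by norm_num⟩
  · rintro ⟨p, h0, h1, -⟩
    refine ⟨fun _ => s, rfl, ?_, hs⟩
    rw [h0] at h1
    by_contra hne
    simp [hne] at h1

/-- For `k * m` not too large, programs with `k` layers and width `m + 3` compute `2 ^ (n/2 * k*m)`
distinct functions, which is too much for programs with far fewer layers. -/
theorem exists_mem_notMem {n k k' m V : ℕ} (hkm : k * m ≤ n / 2)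
    (hcard : n.factorial * (2 ^ (2 * (V ^ 2 * k') * n) * V ^ 2) < 2 ^ (n / 2 * (k * m))) :
    ∃ f ∈ kNOBDDWidth k n (m + 3), f ∉ kNOBDDWidth k' n V := by
  let ext : (Fin (k * m) → Fin (n / 2) → Bool) → ℕ → ℕ → Bool := fun A t i =>
    if h : t < k * m ∧ i < n / 2 then A ⟨t, h.1⟩ ⟨i, h.2⟩ else false
  obtain ⟨A, hA⟩ := exists_notMem_kNOBDDWidth (k := k') (V := V)
    (fun A : Fin (k * m) → Fin (n / 2) → Bool => Pair.pairFn (n := n) k m (ext A)) (by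
      intro A A' h
      funext t i
      have h1 := congrFun h fun x : Fin n => decide ((x : ℕ) = t ∨ (x : ℕ) = n / 2 + i)
      simp only [Pair.pairFn_eq _ hkm t.isLt i.isLt] at h1
      simpa [ext] using h1) (by simpa [← pow_mul] using hcard)
  exact ⟨_, Pair.pairFn_mem k m _, hA⟩

/-! ### The classes of width functions -/

/-- The three kinds of classes of width functions. -/
def IsWidthClass (C : Set (ℕ → ℕ)) : Prop :=
  C = constWidth ∨ C = superpolylogWidth ∨ ∃ α : ℝ, 0 < α ∧ α < 1 / 2 ∧ C = sublinearWidth α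

theorem isBigO_natCast_of_le {u w : ℕ → ℕ} {D : ℕ} (h : ∀ᶠ n in atTop, u n ≤ D * w n) :
    (fun n => (u n : ℝ)) =O[atTop] fun n => (w n : ℝ) := by
  refine IsBigO.of_bound D ?_
  filter_upwards [h] with n hn
  simp only [Real.norm_natCast]
  exact_mod_cast hn

theorem IsWidthClass.exists_le {C : Set (ℕ → ℕ)} (hC : IsWidthClass C) {u w : ℕ → ℕ} (hw : w ∈ C)
    {D : ℕ} (h : ∀ᶠ n in atTop, u n ≤ D * w n) : ∃ v ∈ C, ∀ n, u n ≤ v n := by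
  rcases hC with rfl | rfl | ⟨α, -, -, rfl⟩
  · obtain ⟨c, -, hc⟩ := hw
    obtain ⟨N, hN⟩ := eventually_atTop.1 h
    -- a constant width has to exceed the finitely many exceptional values as well
    refine ⟨fun _ => 21 + D * c + ∑ n ∈ Finset.range N, u n, ⟨_, by omega, fun _ => rfl⟩,
      fun n => ?_⟩
    rcases lt_or_ge n N with hn | hn
    · have := Finset.single_le_sum (f := u) (fun _ _ => Nat.zero_le _) (Finset.mem_range.2 hn)
      simp only
      omega
    · have := hN n hn
      rw [hc n] at this
      simp only
      omega
  · obtain ⟨z, hz⟩ := hw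
    exact ⟨u, ⟨z, (isBigO_natCast_of_le h).trans hz⟩, fun _ => le_rfl⟩
  · exact ⟨u, (isBigO_natCast_of_le h).trans hw, fun _ => le_rfl⟩

theorem IsWidthClass.two_mul_mem {C : Set (ℕ → ℕ)} (hC : IsWidthClass C) {w : ℕ → ℕ}
    (hw : w ∈ C) : (fun n => 2 * w n) ∈ C := by
  have h := isBigO_natCast_of_le (u := fun n => 2 * w n) (w := w) (D := 2)
    (Eventually.of_forall fun n => le_rfl)
  rcases hC with rfl | rfl | ⟨α, -, -, rfl⟩
  · obtain ⟨c, hc, hcw⟩ := hw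
    exact ⟨2 * c, by omega, fun n => by simp only [hcw n]⟩
  · obtain ⟨z, hz⟩ := hw
    exact ⟨z, h.trans hz⟩
  · exact h.trans hw

theorem clog_sq_isLittleO {α : ℝ} (hα : 0 < α) :
    (fun n : ℕ => ((Nat.clog 2 n : ℕ) : ℝ) ^ 2) =o[atTop] fun n : ℕ => (n : ℝ) ^ α := by
  have h1 : (fun x : ℝ => Real.log x ^ (2 : ℝ)) =o[atTop] fun x => x ^ α :=
    isLittleO_log_rpow_rpow_atTop 2 hα
  have h2 := h1.comp_tendsto tendsto_natCast_atTop_atTop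
  refine IsBigO.trans_isLittleO (IsBigO.of_bound ((2 / Real.log 2) ^ 2) ?_) h2
  filter_upwards [eventually_ge_atTop 2] with n hn
  have hlog2 : 0 < Real.log 2 := Real.log_pos one_lt_two
  have hn' : (2 : ℝ) ≤ n := by exact_mod_cast hn
  have hlogn : Real.log 2 ≤ Real.log n := Real.log_le_log two_pos hn'
  have hclog : ((Nat.clog 2 n : ℕ) : ℝ) ≤ Real.logb 2 n + 1 := by
    have h0 : 0 ≤ Real.logb 2 (n : ℝ) := Real.logb_nonneg one_lt_two (by linarith)
    have h3 := Real.natCeil_logb_natCast 2 n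
    rw [← h3]
    exact (Nat.ceil_lt_add_one (by simpa using h0)).le.trans (by simp)
  have hle : ((Nat.clog 2 n : ℕ) : ℝ) ≤ 2 / Real.log 2 * Real.log n := by
    refine hclog.trans ?_
    rw [Real.logb, div_mul_eq_mul_div, le_div_iff₀ hlog2, add_mul, div_mul_cancel₀ _ hlog2.ne']
    linarith
  simp only [Function.comp_apply, Real.rpow_two]
  rw [norm_pow, norm_pow, ← mul_pow, Real.norm_natCast, Real.norm_of_nonneg (hlog2.le.trans hlogn)]
  exact pow_le_pow_left₀ (Nat.cast_nonneg _) hle 2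

/-- Widths which are at most logarithmic may be squared. -/
theorem IsWidthClass.exists_sq_le {C : Set (ℕ → ℕ)} (hC : IsWidthClass C) {w : ℕ → ℕ}
    (hw : w ∈ C) :
    ∃ w' ∈ C, ∀ n, w n ≤ w' n ∧ (w n ≤ Nat.clog 2 n → w n ^ 2 ≤ w' n) := by
  have hsq : ∀ n, w n ≤ w n ^ 2 := fun n => Nat.le_self_pow two_ne_zero _
  rcases hC with rfl | rfl | ⟨α, hα, -, rfl⟩
  · obtain ⟨c, hc, hcw⟩ := hw
    exact ⟨fun n => w n ^ 2, ⟨c ^ 2, hc.trans_le (Nat.le_self_pow two_ne_zero _),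
      fun n => by simp only [hcw n]⟩, fun n => ⟨hsq n, fun _ => le_rfl⟩⟩
  · obtain ⟨z, hz⟩ := hw
    refine ⟨fun n => w n ^ 2, ⟨z * 2, ?_⟩, fun n => ⟨hsq n, fun _ => le_rfl⟩⟩
    have h := hz.pow 2
    refine (IsBigO.trans (IsBigO.of_bound 1 (Eventually.of_forall fun n => ?_)) h).trans
      (IsBigO.of_bound 1 ?_)
    · simp
    · filter_upwards [eventually_ge_atTop 1] with n hn
      have h0 : 0 ≤ Real.logb 2 (n : ℝ) := Real.logb_nonneg one_lt_two (by exact_mod_cast hn)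
      rw [Real.rpow_mul h0, Real.rpow_two, one_mul]
  · refine ⟨fun n => if w n ≤ Nat.clog 2 n then w n ^ 2 else w n, ?_, fun n => ?_⟩
    · have h1 : (fun n => (w n : ℝ) + ((Nat.clog 2 n : ℕ) : ℝ) ^ 2) =O[atTop]
          fun n : ℕ => (n : ℝ) ^ α := IsBigO.add hw (clog_sq_isLittleO hα).isBigO
      refine IsBigO.trans (IsBigO.of_bound 1 (Eventually.of_forall fun n => ?_)) h1
      rw [one_mul, Real.norm_natCast, Real.norm_of_nonneg (by positivity)]
      norm_cast
      beta_reduce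
      split_ifs with h
      · exact (Nat.pow_le_pow_left h 2).trans (Nat.le_add_left _ _)
      · exact Nat.le_add_right _ _
    · beta_reduce
      constructor
      · split_ifs
        · exact hsq n
        · exact le_rfl
      · intro h
        rw [if_pos h]

/-- Finitely many of the functions of a family do not matter. -/
theorem IsWidthClass.mem_kNOBDDClass {C : Set (ℕ → ℕ)} (hC : IsWidthClass C) {k w : ℕ → ℕ}
    (hk : ∀ n, 0 < k n) (hw : w ∈ C) {D : ℕ} {f : BoolFamily}
    (h : ∀ᶠ n in atTop, f n ∈ kNOBDDWidth (k n) n (D * w n)) : f ∈ kNOBDDClass k C := by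
  obtain ⟨N, hN⟩ := eventually_atTop.1 h
  obtain ⟨v, hv, huv⟩ := hC.exists_le (u := fun n => if n < N then 2 ^ n + 1 else D * w n) hw
    (D := D) (by
      filter_upwards [eventually_ge_atTop N] with n hn
      rw [if_neg (by omega)])
  refine ⟨v, hv, fun n => kNOBDDWidth_mono (huv n) ?_⟩
  split_ifs with hn
  · exact mem_kNOBDDWidth_two_pow (hk n) _
  · exact hN n (by omega)

/-! ### Separation for large input lengths -/

theorem addrLen_add_le_blockLen {n K W : ℕ} (hK : 0 < K) (hW : 0 < W)
    (h : SAF.Admissible n K W) : SAF.addrLen K W + 2 * W ≤ SAF.blockLen n K W := by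
  unfold SAF.Admissible at h
  rw [SAF.blockLen, Nat.le_div_iff_mul_le (by positivity), mul_comm]
  refine le_trans (le_of_eq ?_) h.le
  rw [SAF.addrLen]
  ring

theorem safFn_mem {n k w : ℕ} (hk : 4 < k) (hw : 20 < w)
    (h : SAF.Admissible n (k / 2) ((w - 1) / 3)) :
    SAF.fn (n := n) (k / 2) ((w - 1) / 3) ∈ kNOBDDWidth k n (34 * w) := by
  have hL := addrLen_add_le_blockLen (by omega) (by omega) h
  exact kNOBDDWidth_mono (by omega) (kNOBDDWidth_mono_layers (by omega)
    (Lookup.fn_mem_kNOBDDWidth (by omega) (by omega)))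

theorem logb_le_self {w : ℕ} (hw : 0 < w) : Real.logb 2 w ≤ w := by
  rw [Real.logb_le_iff_le_rpow one_lt_two (by exact_mod_cast hw), Real.rpow_natCast]
  exact_mod_cast w.lt_two_pow_self.le

theorem mul_sq_mul_floor_le {k w V : ℕ} {r : ℝ} (hw : 20 < w)
    (hr : 48 * (V : ℝ) ^ 2 / (w * Real.logb 2 w) ≤ r) :
    48 * (V : ℝ) ^ 2 * ⌊(k : ℝ) / r⌋₊ ≤ k * (w * Real.logb 2 w) := by
  have hw' : (1 : ℝ) < w := by exact_mod_cast (by omega : 1 < w)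
  have hlog : 0 < Real.logb 2 w := Real.logb_pos one_lt_two hw'
  have hpos : 0 < (w : ℝ) * Real.logb 2 w := by positivity
  have hr0 : 0 ≤ r := le_trans (by positivity) hr
  have hfl : (⌊(k : ℝ) / r⌋₊ : ℝ) * r ≤ k := by
    rcases hr0.eq_or_lt with h0 | h0
    · rw [← h0, mul_zero]
      positivity
    · exact (le_div_iff₀ h0).1 (Nat.floor_le (by positivity))
  rw [div_le_iff₀ hpos] at hr
  calc 48 * (V : ℝ) ^ 2 * ⌊(k : ℝ) / r⌋₊ ≤ r * (w * Real.logb 2 w) * ⌊(k : ℝ) / r⌋₊ := by gcongr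
    _ = ⌊(k : ℝ) / r⌋₊ * r * (w * Real.logb 2 w) := by ring
    _ ≤ k * (w * Real.logb 2 w) := by gcongr

/-- The bound on `r` is needed for the width `2 * v`: this gains the factor `4` which makes up for
the rounding in `k / 2` and `(w - 1) / 3`. -/
theorem safFn_notMem {n k w v : ℕ} {r : ℝ} (hk : 4 < k) (hw : 20 < w)
    (h : SAF.Admissible n (k / 2) ((w - 1) / 3))
    (hr : 48 * ((2 * v : ℕ) : ℝ) ^ 2 / (w * Real.logb 2 w) < r) :
    SAF.fn (n := n) (k / 2) ((w - 1) / 3) ∉ kNOBDDWidth ⌊(k : ℝ) / r⌋₊ n v := by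
  intro hmem
  set K := k / 2 with hK
  set W := (w - 1) / 3 with hW
  have h1 := pow_le_of_fn_mem (by omega) (addrLen_add_le_blockLen (by omega) (by omega) h) hmem
  have h2 := mul_sq_mul_floor_le (k := k) hw hr.le
  generalize ⌊(k : ℝ) / r⌋₊ = k' at h1 h2
  have hWpos : (0 : ℝ) < W := by exact_mod_cast (by omega : 0 < W)
  have h3 : (((K - 1) * (W - 2) : ℕ) : ℝ) * Real.logb 2 W ≤ ((v ^ 2 * k' : ℕ) : ℝ) := by
    have h4 : (W : ℝ) ^ ((K - 1) * (W - 2)) ≤ (2 : ℝ) ^ (v ^ 2 * k') := by exact_mod_cast h1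
    have h5 := Real.logb_le_logb_of_le one_lt_two (by positivity) h4
    rwa [Real.logb_pow, Real.logb_pow, Real.logb_self_eq_one one_lt_two, mul_one] at h5
  have hlogW : 0 < Real.logb 2 W :=
    Real.logb_pos one_lt_two (by exact_mod_cast (by omega : 1 < W))
  have hlogw : Real.logb 2 w ≤ 2 * Real.logb 2 W := by
    have h4 : (w : ℝ) ≤ (W : ℝ) ^ 2 := by
      have : w ≤ W ^ 2 := by nlinarith [(by omega : w ≤ 3 * W + 3), (by omega : 6 ≤ W)]
      exact_mod_cast this
    have h5 := Real.logb_le_logb_of_le one_lt_two (by exact_mod_cast (by omega : 0 < w)) h4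
    rwa [Real.logb_pow, Nat.cast_ofNat] at h5
  have h6 : (k : ℝ) * w ≤ 30 * ((K - 1) * (W - 2) : ℕ) := by
    have : k * w ≤ 5 * (K - 1) * (6 * (W - 2)) := Nat.mul_le_mul (by omega) (by omega)
    have h7 : k * w ≤ 30 * ((K - 1) * (W - 2)) := this.trans (le_of_eq (by ring))
    exact_mod_cast h7
  have h8 : (1 : ℝ) ≤ ((K - 1) * (W - 2) : ℕ) := by
    have : 0 < (K - 1) * (W - 2) := Nat.mul_pos (by omega) (by omega)
    exact_mod_cast this
  generalize (((K - 1) * (W - 2) : ℕ) : ℝ) = X at h3 h6 h8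
  push_cast at h2 h3
  have h9 : (k : ℝ) * (w * Real.logb 2 w) ≤ 30 * X * (2 * Real.logb 2 W) := by
    rw [← mul_assoc]
    gcongr
    exact Real.logb_nonneg one_lt_two (by exact_mod_cast (by omega : 1 ≤ w))
  have h10 : 0 < X * Real.logb 2 W := by positivity
  -- `192 * X * log W ≤ k * w * log w ≤ 60 * X * log W`
  nlinarith

/-- If the blocks are too short for the addresses, then the number of layers is almost linear, and
counting gives a function that separates. -/
theorem exists_mem_notMem_of_not_admissible {n k w : ℕ} {r : ℝ} (hk : 4 < k) (hw : 20 < w)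
    (h : ¬ SAF.Admissible n (k / 2) ((w - 1) / 3)) (hn : 8 * (k * w ^ 2) ≤ n)
    (hclog : 8 * Nat.clog 2 n ^ 2 ≤ n) :
    w ≤ Nat.clog 2 n ∧ ∃ f ∈ kNOBDDWidth k n (w ^ 2 + 3), ∀ v : ℕ,
      48 * (v : ℝ) ^ 2 / (w * Real.logb 2 w) < r → f ∉ kNOBDDWidth ⌊(k : ℝ) / r⌋₊ n v := by
  set c := Nat.clog 2 n with hc
  set Q := k * w ^ 2 with hQ
  have hkw : 1 ≤ k * w := Nat.mul_pos (by omega) (by omega)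
  have hQkw : Q = k * w * w := by rw [hQ]; ring
  have hQ1 : k * w * 21 ≤ Q := by rw [hQkw]; exact Nat.mul_le_mul_left _ hw
  have hkQ : k ≤ Q := le_trans (Nat.le_mul_of_pos_right _ (by omega : 0 < w)) (by omega)
  have hn2 : 8 ≤ n := by omega
  have hc2 : 2 ≤ c := by
    by_contra hlt
    have h1 : n ≤ 2 ^ c := Nat.le_pow_clog one_lt_two _
    have h2 : 2 ^ c ≤ 2 ^ 1 := Nat.pow_le_pow_right two_pos (by omega)
    omega
  have h2n : 2 * n ≤ k * w * c := by
    unfold SAF.Admissible at h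
    set K := k / 2
    set W := (w - 1) / 3
    have hcK : Nat.clog 2 K ≤ c := Nat.clog_mono_right 2 (by omega)
    have hcW : Nat.clog 2 (2 * W) ≤ w :=
      (Nat.clog_le_of_le_pow (Nat.lt_two_pow_self).le).trans (by omega : 2 * W ≤ w)
    have h1 : 2 * K * W * (2 * W + Nat.clog 2 K + Nat.clog 2 (2 * W)) ≤ 2 * K * W * (2 * w + c) :=
      Nat.mul_le_mul_left _ (by omega)
    have h2 : 2 * K * (W * 3) ≤ k * w := Nat.mul_le_mul (by omega) (by omega)
    have h3 : 2 * K * (W * 3) * (2 * w + c) ≤ k * w * (2 * w + c) := Nat.mul_le_mul_right _ h2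
    have h4 : 2 * K * (W * 3) * (2 * w + c) = 3 * (2 * K * W * (2 * w + c)) := by ring
    have h5 : k * w * (2 * w + c) = 2 * Q + k * w * c := by rw [hQkw]; ring
    omega
  have hwc : w ≤ c := by
    have h1 : 2 * n * w ≤ Q * c := by
      calc 2 * n * w ≤ k * w * c * w := Nat.mul_le_mul_right _ h2n
        _ = Q * c := by rw [hQkw]; ring
    have h2 : Q * c ≤ n * c := Nat.mul_le_mul_right _ (by omega)
    have h3 : n * w ≤ n * c := by
      have : 2 * n * w = n * w + n * w := by ring
      omega
    exact Nat.le_of_mul_le_mul_left h3 (by omega)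
  have hQc : 16 * c ≤ Q := by
    have h1 : 16 * c * c ≤ k * w * c := by
      have : 16 * c * c = 2 * (8 * c ^ 2) := by ring
      omega
    have := Nat.le_of_mul_le_mul_right h1 (by omega)
    omega
  refine ⟨hwc, ?_⟩
  have main : ∀ V k' : ℕ, 48 * (V ^ 2 * k') ≤ Q → V ^ 2 ≤ 2 ^ c →
      ∃ f ∈ kNOBDDWidth k n (w ^ 2 + 3), f ∉ kNOBDDWidth k' n V := by
    intro V k' h1 h2
    refine exists_mem_notMem (by omega) ?_
    have h3 : n.factorial ≤ 2 ^ (c * n) := by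
      rw [pow_mul]
      exact n.factorial_le_pow.trans (Nat.pow_le_pow_left (Nat.le_pow_clog one_lt_two _) _)
    calc n.factorial * (2 ^ (2 * (V ^ 2 * k') * n) * V ^ 2)
        ≤ 2 ^ (c * n) * (2 ^ (2 * (V ^ 2 * k') * n) * 2 ^ c) := by gcongr
      _ = 2 ^ (c * n + (2 * (V ^ 2 * k') * n + c)) := by rw [pow_add, pow_add]
      _ < 2 ^ (n / 2 * Q) := by
        refine Nat.pow_lt_pow_right one_lt_two ?_
        -- the exponent on the left is at most `n * Q * (1/16 + 2/48 + 1/16)`, and `n/2 ≥ n/3`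
        have e1 : 16 * c * n ≤ Q * n := Nat.mul_le_mul_right _ hQc
        have e2 : 48 * (V ^ 2 * k') * n ≤ Q * n := Nat.mul_le_mul_right _ h1
        have e3 : c ≤ c * n := Nat.le_mul_of_pos_right _ (by omega)
        have e4 : n * Q ≤ 3 * (n / 2) * Q := Nat.mul_le_mul_right _ (by omega)
        have e5 : 0 < n * Q := Nat.mul_pos (by omega) (by omega)
        rw [mul_comm Q n, mul_assoc] at e1 e2
        rw [mul_assoc] at e4 ⊢
        omega
  have hlog : 0 < Real.logb 2 (w : ℝ) :=
    Real.logb_pos one_lt_two (by exact_mod_cast (by omega : 1 < w))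
  have hpos : 0 < (w : ℝ) * Real.logb 2 w :=
    mul_pos (by exact_mod_cast (by omega : 0 < w)) hlog
  rcases Nat.eq_zero_or_pos ⌊(k : ℝ) / r⌋₊ with hk0 | hk0
  · -- without layers the width does not matter
    obtain ⟨f, hf, hf'⟩ := main 2 0 (by omega) (Nat.pow_le_pow_right two_pos hc2)
    refine ⟨f, hf, fun v _ hv => hf' ?_⟩
    rw [hk0] at hv
    exact kNOBDDWidth_zero_subset n v hv
  · set V := ⌊Real.sqrt (r * (w * Real.logb 2 w) / 48)⌋₊ with hV
    have hr0 : 0 ≤ r := by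
      by_contra hneg
      rw [Nat.floor_of_nonpos (div_nonpos_of_nonneg_of_nonpos (Nat.cast_nonneg _) (by linarith))]
        at hk0
      exact lt_irrefl _ hk0
    have hV2 : (V : ℝ) ^ 2 ≤ r * (w * Real.logb 2 w) / 48 := by
      rw [← Real.sq_sqrt (by positivity : 0 ≤ r * (w * Real.logb 2 w) / 48)]
      exact pow_le_pow_left₀ (Nat.cast_nonneg _) (Nat.floor_le (Real.sqrt_nonneg _)) 2
    have h1 : 48 * (V ^ 2 * ⌊(k : ℝ) / r⌋₊) ≤ Q := by
      have h2 := mul_sq_mul_floor_le (k := k) (V := V) (r := r) hw (by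
        rw [div_le_iff₀ hpos]
        linarith)
      have h3 : (k : ℝ) * (w * Real.logb 2 w) ≤ k * w ^ 2 := by
        rw [sq]
        gcongr
        exact logb_le_self (by omega)
      have h4 := h2.trans h3
      rw [mul_assoc] at h4
      exact_mod_cast h4
    have h2 : V ^ 2 ≤ V ^ 2 * ⌊(k : ℝ) / r⌋₊ := Nat.le_mul_of_pos_right _ hk0
    have h3 : n ≤ 2 ^ c := Nat.le_pow_clog one_lt_two _
    obtain ⟨f, hf, hf'⟩ := main V _ h1 (by omega)
    refine ⟨f, hf, fun v hv hfv => hf' (kNOBDDWidth_mono ?_ hfv)⟩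
    refine Nat.le_floor (Real.le_sqrt_of_sq_le ?_)
    rw [div_lt_iff₀ hpos] at hv
    linarith

theorem theorem9 (k w : ℕ → ℕ) (r : ℕ → ℝ) (C : Set (ℕ → ℕ))
    (hC : C = constWidth ∨ C = superpolylogWidth ∨
      ∃ α : ℝ, 0 < α ∧ α < 1 / 2 ∧ C = sublinearWidth α)
    (hwC : w ∈ C) (hk : ∀ n, 4 < k n) (hw : ∀ n, 20 < w n)
    (hkw : (fun n => (k n : ℝ) * (w n : ℝ) ^ 2) =o[atTop] fun n : ℕ => (n : ℝ))
    (hr : ∀ v ∈ C, ∀ᶠ n in atTop,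
      48 * (v n : ℝ) ^ 2 / ((w n : ℝ) * Real.logb 2 (w n : ℝ)) < r n) :
    kNOBDDClass (fun n => ⌊(k n : ℝ) / r n⌋₊) C ⊂ kNOBDDClass k C ∧
      ((∀ᶠ n in atTop, SAF.Admissible n (k n / 2) ((w n - 1) / 3)) →
        SAFFamily (fun n => k n / 2) (fun n => (w n - 1) / 3) ∈
          kNOBDDClass k C \ kNOBDDClass (fun n => ⌊(k n : ℝ) / r n⌋₊) C) := by
  classical
  have hC' : IsWidthClass C := hC
  have hk0 : ∀ n, 0 < k n := fun n => by have := hk n; omega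
  have hr2 : ∀ v ∈ C, ∀ᶠ n in atTop,
      48 * ((2 * v n : ℕ) : ℝ) ^ 2 / ((w n : ℝ) * Real.logb 2 (w n : ℝ)) < r n :=
    fun v hv => hr _ (hC'.two_mul_mem hv)
  refine ⟨⟨?_, fun hsub => ?_⟩, fun hadm => ⟨?_, ?_⟩⟩
  · rintro f ⟨v, hv, hf⟩
    refine hC'.mem_kNOBDDClass hk0 hv (D := 1) ?_
    filter_upwards [hr w hwC] with n hn
    rw [one_mul]
    refine kNOBDDWidth_mono_layers ?_ (hf n)
    have hw1 : (1 : ℝ) < w n := by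
      have := hw n
      exact_mod_cast (by omega : 1 < w n)
    have hlog : 0 < Real.logb 2 (w n : ℝ) := Real.logb_pos one_lt_two hw1
    have hle : Real.logb 2 (w n : ℝ) ≤ w n := logb_le_self (by have := hw n; omega)
    have h1 : 1 ≤ r n := by
      refine le_trans ?_ hn.le
      rw [le_div_iff₀ (by positivity)]
      nlinarith
    refine Nat.floor_le_of_le ?_
    exact div_le_self (Nat.cast_nonneg _) h1
  · have hlin : ∀ᶠ n in atTop, 8 * (k n * w n ^ 2) ≤ n := by
      filter_upwards [hkw.bound (by norm_num : (0 : ℝ) < 1 / 8)] with n hn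
      rw [Real.norm_of_nonneg (by positivity), Real.norm_natCast] at hn
      have : 8 * ((k n : ℝ) * (w n : ℝ) ^ 2) ≤ n := by linarith
      exact_mod_cast this
    have hclog : ∀ᶠ n : ℕ in atTop, 8 * Nat.clog 2 n ^ 2 ≤ n := by
      filter_upwards [(clog_sq_isLittleO one_pos).bound (by norm_num : (0 : ℝ) < 1 / 8)] with n hn
      rw [Real.norm_of_nonneg (by positivity), Real.rpow_one, Real.norm_natCast] at hn
      have : 8 * ((Nat.clog 2 n : ℕ) : ℝ) ^ 2 ≤ n := by linarith
      exact_mod_cast this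
    obtain ⟨w', hw', hww'⟩ := hC'.exists_sq_le hwC
    have hsep : ∀ n, ∃ f : (Fin n → Bool) → Bool,
        8 * (k n * w n ^ 2) ≤ n → 8 * Nat.clog 2 n ^ 2 ≤ n →
        f ∈ kNOBDDWidth (k n) n (34 * w' n) ∧ ∀ v : ℕ,
          48 * ((2 * v : ℕ) : ℝ) ^ 2 / (w n * Real.logb 2 (w n)) < r n →
          f ∉ kNOBDDWidth ⌊(k n : ℝ) / r n⌋₊ n v := by
      intro n
      by_cases hlarge : 8 * (k n * w n ^ 2) ≤ n ∧ 8 * Nat.clog 2 n ^ 2 ≤ n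
      · by_cases hadm : SAF.Admissible n (k n / 2) ((w n - 1) / 3)
        · exact ⟨_, fun _ _ => ⟨kNOBDDWidth_mono (Nat.mul_le_mul_left _ (hww' n).1)
            (safFn_mem (hk n) (hw n) hadm), fun v hv => safFn_notMem (hk n) (hw n) hadm hv⟩⟩
        · obtain ⟨hwc, f, hf, hf'⟩ := exists_mem_notMem_of_not_admissible (r := r n) (hk n) (hw n)
            hadm hlarge.1 hlarge.2
          have h1 := (hww' n).2 hwc
          have h2 := (hww' n).1
          have h3 := hw n
          refine ⟨f, fun _ _ => ⟨kNOBDDWidth_mono (by omega) hf, fun v hv hmem =>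
            hf' (2 * v) hv (kNOBDDWidth_mono (by omega) hmem)⟩⟩
      · exact ⟨fun _ => false, fun h1 h2 => absurd ⟨h1, h2⟩ hlarge⟩
    choose f hf using hsep
    have hmem : f ∈ kNOBDDClass k C := by
      refine hC'.mem_kNOBDDClass hk0 hw' (D := 34) ?_
      filter_upwards [hlin, hclog] with n h1 h2
      exact (hf n h1 h2).1
    obtain ⟨v, hv, hfv⟩ := hsub hmem
    obtain ⟨n, h1, h2, h3⟩ := (hlin.and (hclog.and (hr2 v hv))).exists
    exact (hf n h1 h2).2 _ h3 (hfv n)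
  · refine hC'.mem_kNOBDDClass hk0 hwC (D := 34) ?_
    filter_upwards [hadm] with n hn
    exact safFn_mem (hk n) (hw n) hn
  · rintro ⟨v, hv, hfv⟩
    obtain ⟨n, h1, h2⟩ := (hadm.and (hr2 v hv)).exists
    exact safFn_notMem (hk n) (hw n) h1 h2 (hfv n)
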